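/- Let $\mathbb D$ be the open unit disk and $H(\mathbb D)$ the space of analytic functions on $\mathbb D$. A radial weight is a positive continuous function $\nu$ on $\mathbb D$ with $\nu(z)=\nu(|z|)$ that is non-increasing in $|z|$. It is \emph{normal} if for some $\beta>0$ the function $r\mapsto \nu(r)/(1-r^2)^{\beta}$ is almost increasing on $[0,1)$, and for some $\gamma>0$ the function $r\mapsto\nu(r)/(1-r^2)^{\gamma}$ is almost decreasing on $[0,1)$; here $u\ge 0$ is almost increasing (almost decreasing) if there is $C>0$ with $u(r)\le C u(s)$ (respectively $u(s)\le C u(r)$) whenever $0\le r\le s<1$. Let $$\mathcal H^\infty_\nu=\Big\{f\in H(\mathbb D):\ \|f\|=\sup_{z\in\mathbb D}\nu(z)|f(z)|<\infty\Big\},\qquad \mathcal H^0_\nu=\Big\{f\in H(\mathbb D):\ \lim_{|z|\to1^-}\nu(z)|f(z)|=0\Big\}\subset\mathcal H^\infty_\nu ,$$ with $\mathcal H^0_\nu$ carrying the norm of $\mathcal H^\infty_\nu$. For $g\in H(\mathbb D)$ and an analytic map $\phi:\mathbb D\to\mathbb D$ put $$(T^\phi_g f)(z)=\int_0^z f(\phi(\zeta))\,g'(\zeta)\,d\zeta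 ,\qquad f\in H(\mathbb D),\ z\in\mathbb D .$$ Let $\nu,\mu$ be normal weights, $g\in H(\mathbb D)$ and $\phi:\mathbb D\to\mathbb D$ analytic, and suppose that $T^\phi_g:\mathcal H^0_\nu\to\mathcal H^\infty_\mu$ is bounded. Then, for $\kappa\in\{\nu,\mu\}$, the map $\Phi_\kappa$ that sends $F\in(\mathcal H^0_\kappa)''$ to the function $z\mapsto F(\delta_z)$, where $\delta_z\in(\mathcal H^0_\kappa)'$ is evaluation at $z$, is a linear homeomorphism of $(\mathcal H^0_\kappa)''$ onto $\mathcal H^\infty_\kappa$; also $T^\phi_g:\mathcal H^\infty_\nu\to\mathcal H^\infty_\mu$ is bounded; and the following hold. (i) The following are equivalent: (a) $T^\phi_g:\mathcal H^0_\nu\to\mathcal H^\infty_\mu$ is compact; (b) $T^\phi_g:\mathcal H^0_\nu\to\mathcal H^\infty_\mu$ is weakly compact; (c) the bi-transpose $(T^\phi_g)'':(\mathcal H^0_\nu)''\to(\mathcal H^\infty_\mu)''$ of $T^\phi_g:\mathcal H^0_\nu\to\mathcal H^\infty_\mu$ satisfies $(T^\phi_g)''=T^\phi_g$, that is, $(T^\phi_g)''F=J\,T^\phi_g(\Phi_\nu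 F)$ for all $F\in(\mathcal H^0_\nu)''$, where $J:\mathcal H^\infty_\mu\to(\mathcal H^\infty_\mu)''$ is the canonical embedding. (ii) If $\lim_{|z|\to1^-}(1-|z|^2)\mu(z)|g'(z)|=0$ (that is, $g$ belongs to the little weighted Bloch space $\mathcal B^0_{(1-|z|^2)\mu(z)}$), then $T^\phi_g$ maps $\mathcal H^0_\nu$ boundedly into $\mathcal H^0_\mu$, and the bi-transpose of $T^\phi_g:\mathcal H^0_\nu\to\mathcal H^0_\mu$ satisfies $(T^\phi_g)''=T^\phi_g$, that is, $\Phi_\mu\big((T^\phi_g)''F\big)=T^\phi_g(\Phi_\nu F)$ for all $F\in(\mathcal H^0_\nu)''$. Moreover, $T^\phi_g:\mathcal H^0_\nu\to\mathcal H^0_\mu$ is compact if and only if $T^\phi_g(\mathcal H^\infty_\nu)\subset\mathcal H^0_\mu$. -/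

import Mathlib

open Filter Topology

noncomputable section

namespace VolterraComp

/-- The open unit disk of `ℂ`. -/
abbrev disk : Set ℂ := Metric.ball (0 : ℂ) 1

/-- The filter `|z| → 1⁻`. -/
def toBoundary : Filter ℂ := comap (fun z : ℂ => ‖z‖) (𝓝[<] (1 : ℝ))

/-- A radial weight on the unit disk: a positive continuous function of `|z|` that is
non-increasing in `|z|`. Values off the disk are never used. -/
structure RadialWeight where
  toFun : ℂ → ℝ
  continuousOn : ContinuousOn toFun disk
  pos : ∀ z ∈ disk, 0 < toFun z
  radial : ∀ z ∈ disk, toFun z = toFun ((‖z‖ : ℝ) : ℂ)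
  antitone : AntitoneOn (fun r : ℝ => toFun (r : ℂ)) (Set.Ico 0 1)

instance : CoeFun RadialWeight (fun _ => ℂ → ℝ) := ⟨RadialWeight.toFun⟩

/-- `u` is almost increasing on `[0, 1)`. -/
def AlmostIncreasing (u : ℝ → ℝ) : Prop :=
  ∃ C : ℝ, 0 < C ∧ ∀ r ∈ Set.Ico (0 : ℝ) 1, ∀ s ∈ Set.Ico (0 : ℝ) 1, r ≤ s → u r ≤ C * u s

/-- `u` is almost decreasing on `[0, 1)`. -/
def AlmostDecreasing (u : ℝ → ℝ) : Prop :=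
  ∃ C : ℝ, 0 < C ∧ ∀ r ∈ Set.Ico (0 : ℝ) 1, ∀ s ∈ Set.Ico (0 : ℝ) 1, r ≤ s → u s ≤ C * u r

/-- Normal weights in the sense of Shields and Williams. -/
structure RadialWeight.IsNormal (ν : RadialWeight) : Prop where
  almostIncreasing : ∃ β : ℝ, 0 < β ∧
    AlmostIncreasing (fun r : ℝ => ν (r : ℂ) / (1 - r ^ 2) ^ β)
  almostDecreasing : ∃ γ : ℝ, 0 < γ ∧
    AlmostDecreasing (fun r : ℝ => ν (r : ℂ) / (1 - r ^ 2) ^ γ)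

/-- `H(𝔻)`: a holomorphic function on the disk is represented by its extension by zero to `ℂ`,
so that functions agreeing on the disk are equal. -/
def Hol : Submodule ℂ (ℂ → ℂ) where
  carrier := {f | DifferentiableOn ℂ f disk ∧ ∀ z ∉ disk, f z = 0}
  add_mem' := fun hf hg => ⟨hf.1.add hg.1, fun z hz => by
    simp [hf.2 z hz, hg.2 z hz]⟩
  zero_mem' := ⟨differentiableOn_const 0, fun _ _ => rfl⟩
  smul_mem' := fun c _ hf => ⟨hf.1.const_smul c, fun z hz => by simp [hf.2 z hz]⟩

/-- The functions `f` in `H(𝔻)` with `sup ν |f| < ∞`, as a submodule. -/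
def hInfSubmodule (ν : RadialWeight) : Submodule ℂ (ℂ → ℂ) where
  carrier := {f | f ∈ Hol ∧ BddAbove (Set.range fun z : disk => ν z * ‖f z‖)}
  add_mem' := by
    rintro f g ⟨hf, a, ha⟩ ⟨hg, b, hb⟩
    refine ⟨Hol.add_mem hf hg, a + b, ?_⟩
    rintro _ ⟨z, rfl⟩
    have h1 := ha ⟨z, rfl⟩
    have h2 := hb ⟨z, rfl⟩
    have h3 := mul_le_mul_of_nonneg_left (norm_add_le (f z) (g z)) (ν.pos z z.2).le
    simp only [Pi.add_apply] at *
    linarith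
  zero_mem' := ⟨Hol.zero_mem, 0, by rintro _ ⟨z, rfl⟩; simp⟩
  smul_mem' := by
    rintro c f ⟨hf, a, ha⟩
    refine ⟨Hol.smul_mem c hf, ‖c‖ * a, ?_⟩
    rintro _ ⟨z, rfl⟩
    have h1 := mul_le_mul_of_nonneg_left (ha ⟨z, rfl⟩) (norm_nonneg c)
    simp only [Pi.smul_apply, norm_smul] at *
    linarith

/-- The weighted Banach space `H^∞_ν`. It is a type synonym of the submodule above, so that it
carries the weighted sup norm and not the topology of pointwise convergence. -/
def HInf (ν : RadialWeight) : Type := hInfSubmodule ν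

namespace HInf

variable {ν : RadialWeight}

instance : AddCommGroup (HInf ν) := inferInstanceAs (AddCommGroup (hInfSubmodule ν))

instance : Module ℂ (HInf ν) := inferInstanceAs (Module ℂ (hInfSubmodule ν))

instance : CoeFun (HInf ν) (fun _ => ℂ → ℂ) := ⟨fun f => (Subtype.val f : ℂ → ℂ)⟩

/-- `‖f‖ = sup_{|z| < 1} ν(z) |f(z)|`. -/
instance : Norm (HInf ν) := ⟨fun f => ⨆ z : disk, ν z * ‖f z‖⟩

theorem norm_def (f : HInf ν) : ‖f‖ = ⨆ z : disk, ν z * ‖f z‖ := rfl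

theorem weight_mul_le_norm (f : HInf ν) {z : ℂ} (hz : z ∈ disk) : ν z * ‖f z‖ ≤ ‖f‖ :=
  le_ciSup (f := fun z : disk => ν z * ‖f z‖) f.2.2 ⟨z, hz⟩

theorem norm_le {f : HInf ν} {M : ℝ} (h : ∀ z ∈ disk, ν z * ‖f z‖ ≤ M) : ‖f‖ ≤ M :=
  haveI : Nonempty disk := ⟨⟨0, by simp⟩⟩
  ciSup_le fun z => h z z.2

theorem add_apply (f g : HInf ν) (z : ℂ) : (f + g) z = f z + g z := rfl

theorem smul_apply (c : ℂ) (f : HInf ν) (z : ℂ) : (c • f) z = c * f z := rfl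

theorem zero_apply (z : ℂ) : (0 : HInf ν) z = 0 := rfl

theorem apply_eq_zero (f : HInf ν) {z : ℂ} (hz : z ∉ disk) : f z = 0 := f.2.1.2 z hz

theorem normCore : NormedSpace.Core ℂ (HInf ν) where
  norm_nonneg f := Real.iSup_nonneg fun z => mul_nonneg (ν.pos z z.2).le (norm_nonneg _)
  norm_smul c f := by
    rw [norm_def, norm_def, Real.mul_iSup_of_nonneg (norm_nonneg c)]
    refine iSup_congr fun z => ?_
    rw [smul_apply, norm_mul]
    ring
  norm_triangle f g := by
    refine norm_le fun z hz => ?_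
    have h1 := weight_mul_le_norm f hz
    have h2 := weight_mul_le_norm g hz
    have h3 := mul_le_mul_of_nonneg_left (norm_add_le (f z) (g z)) (ν.pos z hz).le
    rw [add_apply]
    linarith
  norm_eq_zero_iff f := by
    constructor
    · intro h
      apply Subtype.ext
      funext z
      by_cases hz : z ∈ disk
      · have h1 := weight_mul_le_norm f hz
        rw [h] at h1
        have h2 : ‖f z‖ ≤ 0 := nonpos_of_mul_nonpos_right h1 (ν.pos z hz)
        exact norm_le_zero_iff.mp h2
      · exact apply_eq_zero f hz
    · rintro rfl
      rw [norm_def]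
      simp [zero_apply]

instance : NormedAddCommGroup (HInf ν) := NormedAddCommGroup.ofCore normCore

instance : NormedSpace ℂ (HInf ν) := NormedSpace.ofCore normCore

/-- Point evaluation on `H^∞_ν` as a continuous linear functional. -/
def evalCLM (ν : RadialWeight) (z : ℂ) : HInf ν →L[ℂ] ℂ :=
  LinearMap.mkContinuous
    { toFun := fun f => f z
      map_add' := fun _ _ => rfl
      map_smul' := fun _ _ => rfl } |(ν z)⁻¹| (by
    intro f
    show ‖f z‖ ≤ |(ν z)⁻¹| * ‖f‖
    by_cases hz : z ∈ disk
    · have hp := ν.pos z hz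
      rw [abs_of_pos (inv_pos.mpr hp), le_inv_mul_iff₀ hp]
      exact weight_mul_le_norm f hz
    · rw [apply_eq_zero f hz, norm_zero]
      positivity)

end HInf

/-- A holomorphic function with `ν |f| → 0` at the boundary belongs to `H^∞_ν`, so defining
`H^0_ν` inside `H^∞_ν` loses nothing. -/
theorem mem_hInfSubmodule_of_tendsto {ν : RadialWeight} {f : ℂ → ℂ} (hf : f ∈ Hol)
    (h : Tendsto (fun z : ℂ => ν z * ‖f z‖) toBoundary (𝓝 0)) : f ∈ hInfSubmodule ν := by
  refine ⟨hf, ?_⟩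
  obtain ⟨t, ht, hts⟩ := mem_comap.mp (h.eventually (gt_mem_nhds one_pos))
  obtain ⟨r, hr, hrt⟩ := (mem_nhdsLT_iff_exists_Ioo_subset (a := (1 : ℝ))).mp ht
  have hsub : Metric.closedBall (0 : ℂ) r ⊆ disk := Metric.closedBall_subset_ball hr
  obtain ⟨M, hM⟩ := (isCompact_closedBall (0 : ℂ) r).bddAbove_image
    ((ν.continuousOn.mul hf.1.continuousOn.norm).mono hsub)
  refine ⟨max M 1, ?_⟩
  rintro _ ⟨z, rfl⟩
  by_cases hz : ‖(z : ℂ)‖ ≤ r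
  · exact le_max_of_le_left (hM ⟨z, by simpa using hz, rfl⟩)
  · have hz1 : ‖(z : ℂ)‖ < 1 := mem_ball_zero_iff.mp z.2
    exact le_max_of_le_right (le_of_lt (hts (hrt ⟨not_le.mp hz, hz1⟩)))

/-- `H^0_ν` as a subspace of `H^∞_ν`, with the norm of `H^∞_ν`. -/
def HZero (ν : RadialWeight) : Submodule ℂ (HInf ν) where
  carrier := {f | Tendsto (fun z : ℂ => ν z * ‖f z‖) toBoundary (𝓝 0)}
  zero_mem' := by
    simpa [HInf.zero_apply] using tendsto_const_nhds
  add_mem' := by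
    intro f g hf hg
    have hev : ∀ᶠ z : ℂ in toBoundary, z ∈ disk :=
      (eventually_mem_nhdsWithin.comap _).mono fun z hz => by simpa using hz
    have hfg := hf.add hg
    rw [add_zero] at hfg
    refine squeeze_zero' (hev.mono fun z hz => ?_) (hev.mono fun z hz => ?_) hfg
    · exact mul_nonneg (ν.pos z hz).le (norm_nonneg _)
    · rw [HInf.add_apply, ← mul_add]
      exact mul_le_mul_of_nonneg_left (norm_add_le _ _) (ν.pos z hz).le
  smul_mem' := by
    intro c f hf
    have h := hf.const_mul ‖c‖
    rw [mul_zero] at h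
    refine h.congr fun z => ?_
    rw [HInf.smul_apply, norm_mul]
    ring

/-- Point evaluation `δ_z` as an element of the dual of `H^0_ν`. -/
def delta (ν : RadialWeight) (z : ℂ) : StrongDual ℂ (HZero ν) :=
  (HInf.evalCLM ν z).comp (HZero ν).subtypeL

/-- The little weighted Bloch space `B^0_w`: `g` is holomorphic on the disk and
`w(z) |g'(z)| → 0` as `|z| → 1⁻`. -/
def MemLittleBloch (w : ℂ → ℝ) (g : ℂ → ℂ) : Prop :=
  DifferentiableOn ℂ g disk ∧ Tendsto (fun z : ℂ => w z * ‖deriv g z‖) toBoundary (𝓝 0)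

/-- `(T_g^φ f)(z) = ∫_0^z f(φ(ζ)) g'(ζ) dζ`, the integral along the segment from `0` to `z`. -/
def volterra (g φ f : ℂ → ℂ) (z : ℂ) : ℂ :=
  ∫ t in (0 : ℝ)..1, f (φ ((t : ℂ) * z)) * deriv g ((t : ℂ) * z) * z

section Operators

variable {X Y : Type} [NormedAddCommGroup X] [NormedSpace ℂ X]
  [NormedAddCommGroup Y] [NormedSpace ℂ Y]

/-- The bidual Banach space. -/
abbrev Bidual (X : Type) [NormedAddCommGroup X] [NormedSpace ℂ X] : Type :=
  StrongDual ℂ (StrongDual ℂ X)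

/-- The transpose `T' : Y' → X'`, `T' y' = y' ∘ T`. -/
def transpose (T : X →L[ℂ] Y) : StrongDual ℂ Y →L[ℂ] StrongDual ℂ X := T.precomp ℂ

/-- The bi-transpose `T'' : X'' → Y''`. -/
def bitranspose (T : X →L[ℂ] Y) : Bidual X →L[ℂ] Bidual Y := transpose (transpose T)

/-- Weakly compact operators: the image of the closed unit ball is relatively weakly compact. -/
def IsWeaklyCompactOp (T : X →L[ℂ] Y) : Prop :=
  IsCompact (closure (toWeakSpace ℂ Y '' (T '' Metric.closedBall (0 : X) 1)))

end Operators

/-- `Φ` is the canonical identification of the bidual of `H^0_ν` with `H^∞_ν`, under which `F`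
in the bidual corresponds to the function `z ↦ F(δ_z)`. -/
def IsCanonical (ν : RadialWeight) (Φ : Bidual (HZero ν) ≃L[ℂ] HInf ν) : Prop :=
  ∀ F : Bidual (HZero ν), ∀ z ∈ disk, Φ F z = F (delta ν z)

end VolterraComp

end

/-!
Suppose that the bi-transpose of an operator `T` on `H^0_ν` takes its values in the target space.
Then `T` is small on those functions of the unit ball that are small at suitable finitely many
points of the disk. Otherwise a gliding hump gives a weakly unconditionally Cauchy series
`∑ h n` of functions with `T (h n)` bounded below; all subseries of `∑ h n` converge in the bidual,
so all subseries of `∑ T (h n)` converge weakly in the target, which forces `T (h n) → 0` by the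
Orlicz–Pettis theorem. Hence `T` is compact. For `T` a functional, the same estimate shows that the
point evaluations span a dense subspace of the dual, so that elements of the bidual are determined
by the functions `z ↦ F(δ_z)`. If `ν` vanishes at the boundary, each `f` in `H^∞_ν` is such a
function: take a weak-* cluster point, in the bidual, of the dilations `z ↦ f (a z)` as `a → 1`.

The operator `T_g^φ` on `H^∞_ν` is the bi-transpose followed by evaluation at the `δ_z`, because
`δ_z ∘ T_g^φ` is a Bochner integral of multiples of the functionals `δ_{φ(tz)}`. A weakly compact
operator maps the dilations, hence their limit `F`, into the target, which closes the circle of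
equivalences. For `g` in the little Bloch space, radial integration gains a factor `1 - |z|`, so
dilated functions, being bounded, are mapped into `H^0_μ`; this subspace is weakly closed, and every
function in `H^0_ν` is the weak limit of its dilations.
-/

noncomputable section

namespace VolterraComp

section FunctionalAnalysis

variable {𝕜 : Type*} [RCLike 𝕜] {E F : Type*} [NormedAddCommGroup E] [NormedSpace 𝕜 E]
  [NormedAddCommGroup F] [NormedSpace 𝕜 F]

theorem mem_of_forall_dual_tendsto {p : Submodule 𝕜 E} (hp : IsClosed (p : Set E))
    {α : Type*} {l : Filter α} [l.NeBot] {u : α → E} {x : E} (hu : ∀ a, u a ∈ p)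
    (hx : ∀ x' : StrongDual 𝕜 E, Tendsto (fun a => x' (u a)) l (𝓝 (x' x))) : x ∈ p := by
  let _ : NormedSpace ℝ E := NormedSpace.restrictScalars ℝ 𝕜 E
  have hweak : Tendsto (fun a => toWeakSpace 𝕜 E (u a)) l (𝓝 (toWeakSpace 𝕜 E x)) :=
    (WeakBilin.tendsto_iff_forall_eval_tendsto (topDualPairing 𝕜 E).flip
      (separatingDual_iff_injective.mp inferInstance)).mpr hx
  have hmem := mem_closure_of_tendsto hweak
    (Eventually.of_forall fun a => Set.mem_image_of_mem (toWeakSpace 𝕜 E)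
      (show u a ∈ (p.restrictScalars ℝ : Set E) from hu a))
  rw [← Convex.toWeakSpace_closure 𝕜 (p.restrictScalars ℝ).convex] at hmem
  obtain ⟨z, hz, hzx⟩ := hmem
  rw [← (toWeakSpace 𝕜 E).injective hzx]
  exact hp.closure_subset hz

theorem isSeparable_range_of_hasSum_indicator {ι : Type*} [Countable ι] {x : ι → E}
    {y : Set ι → E}
    (hy : ∀ A, ∀ x' : StrongDual 𝕜 E, HasSum (A.indicator fun i => x' (x i)) (x' (y A))) :
    TopologicalSpace.IsSeparable (Set.range y) := by
  refine (((Set.countable_range x).isSeparable.span (R := 𝕜)).closure).mono ?_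
  rintro _ ⟨A, rfl⟩
  refine mem_of_forall_dual_tendsto (p := (Submodule.span 𝕜 (Set.range x)).topologicalClosure)
    isClosed_closure (u := fun s : Finset ι => ∑ i ∈ s, A.indicator x i) (l := atTop)
    (fun s => Submodule.sum_mem _ fun i _ => ?_) fun x' => (hy A x').congr fun s => ?_
  · by_cases hi : i ∈ A
    · rw [Set.indicator_of_mem hi]
      exact Submodule.le_topologicalClosure _ (Submodule.subset_span (Set.mem_range_self i))
    · rw [Set.indicator_of_notMem hi]
      exact Submodule.zero_mem _
  · rw [map_sum]
    exact Finset.sum_congr rfl fun i _ => congrFun (Set.indicator_comp_of_zero (map_zero x')) i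

theorem isClosed_preimage_closedBall_of_continuous_dual {Ω : Type*} [TopologicalSpace Ω]
    {f : Ω → E} (hf : ∀ x' : StrongDual 𝕜 E, Continuous fun ω => x' (f ω)) (c : E) {ε : ℝ}
    (hε : 0 ≤ ε) : IsClosed (f ⁻¹' Metric.closedBall c ε) := by
  have heq : f ⁻¹' Metric.closedBall c ε =
      ⋂ x' : StrongDual 𝕜 E, {ω | ‖x' (f ω) - x' c‖ ≤ ε * ‖x'‖} := by
    ext ω
    simp only [Set.mem_preimage, mem_closedBall_iff_norm, Set.mem_iInter, Set.mem_ofPred_eq,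
      ← map_sub]
    exact ⟨fun h x' => mul_comm ε ‖x'‖ ▸ x'.le_opNorm_of_le h,
      NormedSpace.norm_le_dual_bound 𝕜 _ hε⟩
  rw [heq]
  exact isClosed_iInter fun x' => isClosed_le ((hf x').sub continuous_const).norm continuous_const

theorem exists_isOpen_forall_norm_sub_le {Ω : Type*} [TopologicalSpace Ω] [BaireSpace Ω]
    [Nonempty Ω] {f : Ω → E} (hf : ∀ x' : StrongDual 𝕜 E, Continuous fun ω => x' (f ω))
    (hsep : TopologicalSpace.IsSeparable (Set.range f)) {ε : ℝ} (hε : 0 < ε) :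
    ∃ U : Set Ω, IsOpen U ∧ U.Nonempty ∧ ∃ c, ∀ ω ∈ U, ‖f ω - c‖ ≤ ε := by
  obtain ⟨D, hD, hsub⟩ := hsep
  have := hD.to_subtype
  have hcover : ⋃ d : D, f ⁻¹' Metric.closedBall d ε = Set.univ := by
    refine Set.eq_univ_of_forall fun ω => ?_
    obtain ⟨d, hd, hdist⟩ := Metric.mem_closure_iff.mp (hsub (Set.mem_range_self ω)) ε hε
    exact Set.mem_iUnion.mpr ⟨⟨d, hd⟩, hdist.le⟩
  obtain ⟨d, hd⟩ := nonempty_interior_of_iUnion_of_closed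
    (fun d : D => isClosed_preimage_closedBall_of_continuous_dual (𝕜 := 𝕜) hf (d : E) hε.le) hcover
  exact ⟨_, isOpen_interior, hd, d, fun ω hω => mem_closedBall_iff_norm.mp <|
    show f ω ∈ Metric.closedBall (d : E) ε from (interior_subset :
      interior (f ⁻¹' Metric.closedBall (d : E) ε) ⊆ _) hω⟩

theorem continuous_dual_sum_of_hasSum_indicator {ι : Type*} {x : ι → E} {y : Set ι → E}
    {x' : StrongDual 𝕜 E} (hy : ∀ A, HasSum (A.indicator fun i => x' (x i)) (x' (y A))) :
    Continuous fun ω : ι → Bool => x' (y {i | ω i = true}) := by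
  have hsum : Summable fun i => ‖x' (x i)‖ := by
    simpa using (hy Set.univ).summable.norm
  simp_rw [← (hy _).tsum_eq, Set.indicator_apply, Set.mem_ofPred_eq]
  refine continuous_tsum (fun i => ?_) hsum fun i ω => ?_
  · exact (continuous_of_discreteTopology
      (f := fun b : Bool => if b = true then x' (x i) else 0)).comp (continuous_apply i)
  · split_ifs <;> simp

-- Baire category on the Cantor space: the sums `y A` lie in a separable set, so some cylinder is
-- mapped into a small ball, and switching one free coordinate changes the sum by one term.
theorem tendsto_cofinite_zero_of_hasSum_indicator {ι : Type*} [Countable ι] {x : ι → E}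
    {y : Set ι → E}
    (hy : ∀ A, ∀ x' : StrongDual 𝕜 E, HasSum (A.indicator fun i => x' (x i)) (x' (y A))) :
    Tendsto x cofinite (𝓝 0) := by
  classical
  let f : (ι → Bool) → E := fun ω => y {i | ω i = true}
  have hflip : ∀ (ω : ι → Bool) (i : ι),
      f (Function.update ω i true) - f (Function.update ω i false) = x i := by
    intro ω i
    refine (SeparatingDual.eq_iff_forall_dual_eq (R := 𝕜)).mpr fun x' => ?_
    rw [map_sub]
    refine (((hy _ x').sub (hy _ x')).unique (hasSum_single i fun j hj => ?_)).trans ?_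
    · simp [Set.indicator_apply, hj]
    · simp
  refine Metric.tendsto_nhds.mpr fun ε hε => ?_
  obtain ⟨U, hU, ⟨ω, hω⟩, c, hc⟩ := exists_isOpen_forall_norm_sub_le (𝕜 := 𝕜) (f := f)
    (fun x' => continuous_dual_sum_of_hasSum_indicator fun A => hy A x')
    ((isSeparable_range_of_hasSum_indicator hy).mono (Set.range_comp_subset_range _ y))
    (show 0 < ε / 3 by positivity)
  obtain ⟨I, V, hV, hVU⟩ := isOpen_pi_iff.mp hU ω hω
  refine I.finite_toSet.subset fun i hi => ?_
  by_contra hiI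
  have hmem : ∀ b, Function.update ω i b ∈ U := fun b => hVU fun j hj => by
    rw [Function.update_of_ne (ne_of_mem_of_not_mem hj hiI)]
    exact (hV j hj).2
  refine hi (?_ : dist (x i) 0 < ε)
  calc dist (x i) 0
      = ‖(f (Function.update ω i true) - c) - (f (Function.update ω i false) - c)‖ := by
        rw [dist_zero_right, sub_sub_sub_cancel_right, hflip]
    _ ≤ ε / 3 + ε / 3 := norm_sub_le_of_le (hc _ (hmem true)) (hc _ (hmem false))
    _ < ε := by linarith

theorem summable_norm_dual_of_norm_sum_smul_le {ι : Type*} {x : ι → E} {B : ℝ}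
    (hx : ∀ (s : Finset ι) (c : ι → 𝕜), (∀ i, ‖c i‖ ≤ 1) → ‖∑ i ∈ s, c i • x i‖ ≤ B)
    (x' : StrongDual 𝕜 E) : Summable fun i => ‖x' (x i)‖ := by
  choose c hc1 hc using fun i => RCLike.exists_norm_eq_mul_self (x' (x i))
  refine summable_of_sum_le (c := ‖x'‖ * B) (fun i => norm_nonneg _) fun s => ?_
  calc ∑ i ∈ s, ‖x' (x i)‖ = ‖x' (∑ i ∈ s, c i • x i)‖ := by
        simp only [map_sum, map_smul, smul_eq_mul, ← hc]
        rw [← RCLike.ofReal_sum, RCLike.norm_of_nonneg (Finset.sum_nonneg fun i _ => norm_nonneg _)]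
    _ ≤ ‖x'‖ * B := x'.le_opNorm_of_le (hx s c fun i => (hc1 i).le)

theorem mem_span_of_forall_apply_eq_zero {s : Finset (StrongDual 𝕜 E)} {x' : StrongDual 𝕜 E}
    (h : ∀ x, (∀ y' ∈ s, y' x = 0) → x' x = 0) :
    x' ∈ Submodule.span 𝕜 (s : Set (StrongDual 𝕜 E)) := by
  have hker : ⨅ y' : s, LinearMap.ker (y'.1 : E →ₗ[𝕜] 𝕜) ≤ LinearMap.ker (x' : E →ₗ[𝕜] 𝕜) :=
    fun x hx => h x fun y' hy' => (Submodule.mem_iInf _).mp hx ⟨y', hy'⟩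
  obtain ⟨c, hc⟩ :=
    (Submodule.mem_span_range_iff_exists_fun 𝕜).mp (mem_span_of_iInf_ker_le_ker hker)
  have hsum : x' = ∑ y' : s, c y' • y'.1 := by
    refine ContinuousLinearMap.coe_injective (hc.symm.trans ?_)
    ext x
    simp
  rw [hsum]
  exact Submodule.sum_mem _ fun y' _ => Submodule.smul_mem _ _ (Submodule.subset_span y'.2)

/-- `T` is continuous at `0` on the closed unit ball for the weak topology induced by a set `S` of
functionals. For linear `T` and `S` this makes `T` a limit, uniform on the unit ball, of operators
that factor through finitely many members of `S`. -/
def IsBallContinuous (S : Set (StrongDual 𝕜 E)) (T : E →L[𝕜] F) : Prop :=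
  ∀ ε > 0, ∃ s : Finset (StrongDual 𝕜 E), (s : Set (StrongDual 𝕜 E)) ⊆ S ∧
    ∃ d > 0, ∀ x : E, ‖x‖ ≤ 1 → (∀ x' ∈ s, ‖x' x‖ ≤ d) → ‖T x‖ ≤ ε

namespace IsBallContinuous

variable {S : Set (StrongDual 𝕜 E)}

theorem isCompactOperator [CompleteSpace F] {T : E →L[𝕜] F} (hT : IsBallContinuous S T) :
    IsCompactOperator T := by
  refine (isCompactOperator_iff_isCompact_closure_image_closedBall (T : E →ₗ[𝕜] F)
    one_pos).mpr (TotallyBounded.closure ?_ |>.isCompact_of_isClosed isClosed_closure)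
  refine Metric.totallyBounded_iff.mpr fun ε hε => ?_
  obtain ⟨s, -, d, hd, hs⟩ := hT (ε / 3) (by positivity)
  let L : E →L[𝕜] (s → 𝕜) := ContinuousLinearMap.pi fun x' => x'.1
  have hL : TotallyBounded (L '' Metric.closedBall 0 1) :=
    have hbdd := L.lipschitz.isBounded_image Metric.isBounded_closedBall
    hbdd.isCompact_closure.totallyBounded.subset subset_closure
  obtain ⟨u, hu, huf, hcover⟩ := Set.exists_subset_image_finite_and.mp
    (Metric.finite_approx_of_totallyBounded hL (2 * d) (by positivity))
  refine ⟨T '' u, huf.image T, ?_⟩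
  rintro _ ⟨x, hx, rfl⟩
  obtain ⟨_, ⟨z, hz, rfl⟩, hxz⟩ := Set.mem_iUnion₂.mp (hcover ⟨x, hx, rfl⟩)
  refine Set.mem_iUnion₂.mpr ⟨T z, ⟨z, hz, rfl⟩, ?_⟩
  have hhalf : ‖T ((2 : 𝕜)⁻¹ • (x - z))‖ ≤ ε / 3 := by
    refine hs _ ?_ fun x' hx' => ?_
    · rw [norm_smul, norm_inv, RCLike.norm_ofNat]
      linarith [norm_sub_le_of_le (mem_closedBall_zero_iff.mp hx)
        (mem_closedBall_zero_iff.mp (hu hz))]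
    · have hcoord := (dist_le_pi_dist (L x) (L z) ⟨x', hx'⟩).trans_lt hxz
      rw [dist_eq_norm] at hcoord
      rw [map_smul, map_sub, norm_smul, norm_inv, RCLike.norm_ofNat]
      change ‖x' x - x' z‖ < 2 * d at hcoord
      linarith
  rw [map_smul, norm_smul, norm_inv, RCLike.norm_ofNat, map_sub] at hhalf
  rw [Metric.mem_ball, dist_eq_norm]
  change ‖T x - T z‖ < ε
  linarith

theorem mem_topologicalClosure_span {x' : StrongDual 𝕜 E} (hx' : IsBallContinuous S x') :
    x' ∈ (Submodule.span 𝕜 S).topologicalClosure := by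
  refine Metric.mem_closure_iff.mpr fun ε hε => ?_
  obtain ⟨s, hsS, d, hd, hs⟩ := hx' (ε / 2) (half_pos hε)
  let p : Submodule 𝕜 E := ⨅ y' ∈ s, LinearMap.ker (y' : E →ₗ[𝕜] 𝕜)
  have hp : ∀ x, x ∈ p ↔ ∀ y' ∈ s, y' x = 0 := fun x => by simp [p, Submodule.mem_iInf]
  have hnorm : ‖x'.comp p.subtypeL‖ ≤ ε / 2 :=
    ContinuousLinearMap.opNorm_le_of_unit_norm (half_pos hε).le fun x hx =>
      hs x hx.le fun y' hy' => by rw [(hp x).mp x.2 y' hy', norm_zero]; exact hd.le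
  obtain ⟨z', hz', hz'norm⟩ := exists_extension_norm_eq p (x'.comp p.subtypeL)
  refine ⟨x' - z', Submodule.span_mono hsS (mem_span_of_forall_apply_eq_zero fun x hx => ?_), ?_⟩
  · have heq : z' x = x' x := hz' ⟨x, (hp x).mpr hx⟩
    rw [sub_apply, heq, sub_self]
  · rw [dist_eq_norm, sub_sub_cancel, hz'norm]
    exact hnorm.trans_lt (half_lt_self hε)

end IsBallContinuous

theorem tendsto_apply_of_mem_topologicalClosure_span {α : Type*} {l : Filter α}
    {u : α → E →L[𝕜] F} {v : E →L[𝕜] F} {R : ℝ} (hu : ∀ a, ‖u a‖ ≤ R) {S : Set E}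
    (hS : ∀ x ∈ S, Tendsto (fun a => u a x) l (𝓝 (v x))) {x : E}
    (hx : x ∈ (Submodule.span 𝕜 S).topologicalClosure) :
    Tendsto (fun a => u a x) l (𝓝 (v x)) := by
  have hspan : ∀ x ∈ Submodule.span 𝕜 S, Tendsto (fun a => u a x) l (𝓝 (v x)) := by
    intro x hx
    induction hx using Submodule.span_induction with
    | mem x hx => exact hS x hx
    | zero => simpa using tendsto_const_nhds
    | add x y _ _ hx hy => simpa using hx.add hy
    | smul c x _ hx => simpa using hx.const_smul c
  have hequi : Equicontinuous ((↑) ∘ u : α → E → F) :=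
    ((NormedSpace.equicontinuous_TFAE u).out 5 1).mp
      (show ∃ C, ∀ a, ‖u a‖ ≤ C from ⟨R, hu⟩)
  exact (hequi x).tendsto_of_mem_closure v.continuous.continuousWithinAt hspan hx

end FunctionalAnalysis

section Biduals

variable {X Y : Type} [NormedAddCommGroup X] [NormedSpace ℂ X] [NormedAddCommGroup Y]
  [NormedSpace ℂ Y]

theorem exists_bidual_forall_tendsto {ι : Type*} (U : Ultrafilter ι) {x : ι → X} {R : ℝ}
    (hx : ∀ i, ‖x i‖ ≤ R) :
    ∃ F : Bidual X, ∀ x', Tendsto (fun i => x' (x i)) U (𝓝 (F x')) := by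
  obtain ⟨F, -, hF⟩ := isCompact_iff_ultrafilter_le_nhds.mp
    (WeakDual.isCompact_closedBall (𝕜 := ℂ) (0 : Bidual X) R)
    (U.map fun i => StrongDual.toWeakDual (NormedSpace.inclusionInDoubleDual ℂ X (x i)))
    (tendsto_principal.mpr (Eventually.of_forall fun i => by
      simpa using (NormedSpace.double_dual_bound ℂ X (x i)).trans (hx i)))
  exact ⟨WeakDual.toStrongDual F, fun x' =>
    ((WeakDual.eval_continuous (𝕜 := ℂ) x').tendsto F).comp hF⟩

theorem tendsto_bidual_apply_of_mem_topologicalClosure_span {α : Type*} {l : Filter α} {x : α → X}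
    {R : ℝ} (hx : ∀ a, ‖x a‖ ≤ R) {F : Bidual X} {S : Set (StrongDual ℂ X)}
    (hS : ∀ x' ∈ S, Tendsto (fun a => x' (x a)) l (𝓝 (F x'))) {x' : StrongDual ℂ X}
    (hx' : x' ∈ (Submodule.span ℂ S).topologicalClosure) :
    Tendsto (fun a => x' (x a)) l (𝓝 (F x')) :=
  tendsto_apply_of_mem_topologicalClosure_span
    (u := fun a => NormedSpace.inclusionInDoubleDual ℂ X (x a))
    (fun a => (NormedSpace.double_dual_bound ℂ X (x a)).trans (hx a)) hS hx'

/-- A bijective operator defined on a bidual, as a linear homeomorphism. -/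
def bidualEquivOfBijective [CompleteSpace Y] (L : Bidual X →L[ℂ] Y) (hL : Function.Bijective L) :
    Bidual X ≃L[ℂ] Y :=
  ContinuousLinearEquiv.ofBijective (𝕜 := ℂ) (𝕜' := ℂ) (σ := RingHom.id ℂ) (E := Bidual X)
    (F := Y) L (LinearMap.ker_eq_bot.mpr hL.1) (LinearMap.range_eq_top.mpr hL.2)

theorem exists_bidual_hasSum_indicator {ι : Type*} [Countable ι] {h : ι → X}
    (hh : ∀ x' : StrongDual ℂ X, Summable fun i => ‖x' (h i)‖) (A : Set ι) :
    ∃ F : Bidual X, ∀ x', HasSum (A.indicator fun i => x' (h i)) (F x') := by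
  let g : Finset ι → Bidual X := fun s =>
    ∑ i ∈ s, A.indicator (fun i => NormedSpace.inclusionInDoubleDual ℂ X (h i)) i
  have hg : ∀ s x', g s x' = ∑ i ∈ s, A.indicator (fun i => x' (h i)) i := by
    intro s x'
    rw [sum_apply]
    refine Finset.sum_congr rfl fun i _ => ?_
    by_cases hi : i ∈ A
    · simp only [Set.indicator_of_mem hi, NormedSpace.dual_def]
    · simp only [Set.indicator_of_notMem hi, zero_apply]
  have hsum : ∀ x' : StrongDual ℂ X, HasSum (A.indicator fun i => x' (h i))
      (∑' i, A.indicator (fun i => x' (h i)) i) := fun x' =>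
    ((hh x').of_norm.indicator A).hasSum
  exact ⟨continuousLinearMapOfTendsto g (tendsto_pi_nhds.mpr fun x' =>
    (hsum x').congr fun s => (hg s x').symm), hsum⟩

theorem bidual_apply_eq_intervalIntegral {u : ℝ → StrongDual ℂ X} {a b : ℝ}
    (hu : IntervalIntegrable u MeasureTheory.volume a b) {x' : StrongDual ℂ X}
    (hx' : ∀ x, x' x = ∫ t in a..b, u t x) (F : Bidual X) : F x' = ∫ t in a..b, F (u t) := by
  rw [ContinuousLinearMap.intervalIntegral_comp_comm F hu]
  congr 1
  ext x
  rw [hx', ContinuousLinearMap.intervalIntegral_apply hu]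

theorem bitranspose_apply (T : X →L[ℂ] Y) (F : Bidual X) (y' : StrongDual ℂ Y) :
    bitranspose T F y' = F (y'.comp T) := rfl

theorem tendsto_cofinite_zero_of_bitranspose_mem_range {T : X →L[ℂ] Y}
    (hT : ∀ F, bitranspose T F ∈ Set.range (NormedSpace.inclusionInDoubleDual ℂ Y))
    {ι : Type*} [Countable ι] {h : ι → X}
    (hh : ∀ x' : StrongDual ℂ X, Summable fun i => ‖x' (h i)‖) :
    Tendsto (fun i => T (h i)) cofinite (𝓝 0) := by
  choose F hF using exists_bidual_hasSum_indicator hh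
  choose y hy using fun A => hT (F A)
  refine tendsto_cofinite_zero_of_hasSum_indicator (𝕜 := ℂ) (y := y) fun A y' => ?_
  have hyA : y' (y A) = F A (y'.comp T) := by
    rw [← bitranspose_apply, ← hy, NormedSpace.dual_def]
  rw [hyA]
  exact hF A (y'.comp T)

theorem bitranspose_functional_mem_range (x' : StrongDual ℂ X) (F : Bidual X) :
    bitranspose x' F ∈ Set.range (NormedSpace.inclusionInDoubleDual ℂ ℂ) := by
  refine ⟨F x', ContinuousLinearMap.ext fun c' => ?_⟩
  have hcomp : c'.comp x' = c' 1 • x' := by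
    ext x
    simpa [mul_comm] using c'.map_smul (x' x) 1
  rw [bitranspose_apply, hcomp, map_smul, NormedSpace.dual_def]
  simpa [mul_comm] using c'.map_smul (F x') 1

theorem isWeaklyCompactOp_of_isCompactOperator {T : X →L[ℂ] Y} (hT : IsCompactOperator T) :
    IsWeaklyCompactOp T := by
  have hK := ((isCompactOperator_iff_isCompact_closure_image_closedBall (T : X →ₗ[ℂ] Y)
    one_pos).mp hT).image (toWeakSpaceCLM ℂ Y).continuous
  exact hK.closure_of_subset (Set.image_mono subset_closure)

theorem bitranspose_mem_range_of_isWeaklyCompactOp {T : X →L[ℂ] Y} (hT : IsWeaklyCompactOp T)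
    {ι : Type*} {l : Filter ι} [l.NeBot] {x : ι → X} {R : ℝ} (hx : ∀ i, ‖x i‖ ≤ R)
    {F : Bidual X} (hF : ∀ x', Tendsto (fun i => x' (x i)) l (𝓝 (F x'))) :
    bitranspose T F ∈ Set.range (NormedSpace.inclusionInDoubleDual ℂ Y) := by
  let c : ℂ := ((|R| + 1 : ℝ) : ℂ)
  have hc : ‖c‖ = |R| + 1 := by rw [Complex.norm_real, Real.norm_of_nonneg (by positivity)]
  have hc0 : c ≠ 0 := norm_pos_iff.mp (by rw [hc]; positivity)
  have hmem : ∀ i, c⁻¹ • x i ∈ Metric.closedBall (0 : X) 1 := fun i => by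
    rw [mem_closedBall_zero_iff, norm_smul, norm_inv, hc, inv_mul_le_one₀ (by positivity)]
    linarith [hx i, le_abs_self R]
  obtain ⟨y, -, hy⟩ := isCompact_iff_ultrafilter_le_nhds.mp hT
    ((Ultrafilter.of l).map fun i => toWeakSpace ℂ Y (T (c⁻¹ • x i)))
    (tendsto_principal.mpr (Eventually.of_forall fun i =>
      subset_closure (Set.mem_image_of_mem _ (Set.mem_image_of_mem T (hmem i)))))
  refine ⟨c • (toWeakSpace ℂ Y).symm y, ContinuousLinearMap.ext fun y' => ?_⟩
  have hlim : Tendsto (fun i => y' (T (c⁻¹ • x i))) (Ultrafilter.of l)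
      (𝓝 (y' ((toWeakSpace ℂ Y).symm y))) :=
    ((WeakBilin.eval_continuous (topDualPairing ℂ Y).flip y').tendsto y).comp hy
  refine tendsto_nhds_unique ?_ ((hF (y'.comp T)).mono_left (Ultrafilter.of_le l))
  rw [NormedSpace.dual_def, map_smul]
  refine (hlim.const_smul c).congr fun i => ?_
  rw [map_smul, map_smul, smul_inv_smul₀ hc0]
  rfl

end Biduals

section HolomorphicFamilies

variable {E F : Type*} [NormedAddCommGroup E] [NormedSpace ℂ E] [NormedAddCommGroup F]
  [NormedSpace ℂ F] [CompleteSpace F]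

theorem norm_dslope_sub_deriv_le {f : ℂ → F} {c z : ℂ} {R M : ℝ}
    (hf : DifferentiableOn ℂ f (Metric.ball c R)) (hM : ∀ w ∈ Metric.ball c R, ‖f w‖ ≤ M)
    (hz : z ∈ Metric.ball c R) :
    ‖dslope f c z - deriv f c‖ ≤ 4 * M / R ^ 2 * dist z c := by
  have hR : 0 < R := Metric.pos_of_mem_ball hz
  have hmaps : Set.MapsTo f (Metric.ball c R) (Metric.closedBall (f c) (2 * M)) := fun w hw => by
    rw [mem_closedBall_iff_norm, two_mul]
    exact norm_sub_le_of_le (hM w hw) (hM c (Metric.mem_ball_self hR))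
  have hslope : ∀ w ∈ Metric.ball c R, ‖dslope f c w‖ ≤ 2 * M / R := fun w hw =>
    Complex.norm_dslope_le_div_of_mapsTo_ball hf hmaps hw
  have hschwarz := Complex.dist_le_div_mul_dist_of_mapsTo_ball (R₂ := 2 * (2 * M / R))
    ((Complex.differentiableOn_dslope (Metric.ball_mem_nhds c hR)).mpr hf) (fun w hw => by
      rw [mem_closedBall_iff_norm, two_mul]
      exact norm_sub_le_of_le (hslope w hw) (hslope c (Metric.mem_ball_self hR))) hz
  rw [dslope_same, dist_eq_norm] at hschwarz
  refine hschwarz.trans_eq ?_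
  field_simp
  ring

-- The difference quotients are Cauchy in operator norm, since the scalar ones converge at a rate
-- depending only on a bound for the functions.
theorem differentiableAt_of_forall_apply {u : ℂ → E →L[ℂ] F} {c : ℂ} {R M : ℝ} (hR : 0 < R)
    (hu : ∀ x, DifferentiableOn ℂ (fun z => u z x) (Metric.ball c R))
    (hM : ∀ z ∈ Metric.ball c R, ‖u z‖ ≤ M) : DifferentiableAt ℂ u c := by
  have hscalar : ∀ x, ∀ z ∈ Metric.ball c R, z ≠ c →
      ‖slope u c z x - deriv (fun w => u w x) c‖ ≤ 4 * (M * ‖x‖) / R ^ 2 * dist z c := by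
    intro x z hz hzc
    have hslope : slope u c z x = dslope (fun w => u w x) c z := by
      rw [dslope_of_ne _ hzc]
      simp [slope_def_module]
    rw [hslope]
    exact norm_dslope_sub_deriv_le (hu x) (fun w hw => (u w).le_of_opNorm_le (hM w hw) x) hz
  have hcauchy : ∀ z ∈ Metric.ball c R, z ≠ c → ∀ w ∈ Metric.ball c R, w ≠ c →
      dist (slope u c z) (slope u c w) ≤ 4 * M / R ^ 2 * (dist z c + dist w c) := by
    intro z hz hzc w hw hwc
    have hM0 : 0 ≤ M := (norm_nonneg _).trans (hM z hz)
    rw [dist_eq_norm]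
    refine ContinuousLinearMap.opNorm_le_bound _ (by positivity) fun x => ?_
    rw [sub_apply, ← sub_sub_sub_cancel_right _ _ (deriv (fun w => u w x) c)]
    exact (norm_sub_le_of_le (hscalar x z hz hzc) (hscalar x w hw hwc)).trans_eq (by ring)
  have hlim : Tendsto (fun p : ℂ × ℂ => 4 * M / R ^ 2 * (dist p.1 c + dist p.2 c))
      (𝓝[≠] c ×ˢ 𝓝[≠] c) (𝓝 0) := by
    have hcont : Continuous fun p : ℂ × ℂ => 4 * M / R ^ 2 * (dist p.1 c + dist p.2 c) := by
      fun_prop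
    simpa using (hcont.tendsto (c, c)).mono_left
      (nhds_prod_eq (x := c) (y := c) ▸ prod_mono nhdsWithin_le_nhds nhdsWithin_le_nhds)
  have hball : ∀ᶠ z in 𝓝[≠] c, z ∈ Metric.ball c R ∧ z ≠ c :=
    (eventually_nhdsWithin_of_eventually_nhds (Metric.ball_mem_nhds c hR)).and
      eventually_mem_nhdsWithin
  have hdist : Tendsto (fun p : ℂ × ℂ => dist (slope u c p.1) (slope u c p.2))
      (𝓝[≠] c ×ˢ 𝓝[≠] c) (𝓝 0) :=
    squeeze_zero' (Eventually.of_forall fun _ => dist_nonneg)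
      ((hball.prod_mk hball).mono fun p hp =>
        hcauchy p.1 hp.1.1 hp.1.2 p.2 hp.2.1 hp.2.2) hlim
  have hmap : Cauchy (map (slope u c) (𝓝[≠] c)) := cauchy_map_iff.mpr
    ⟨inferInstance, tendsto_uniformity_iff_dist_tendsto_zero.mpr hdist⟩
  obtain ⟨L, hL⟩ := cauchy_map_iff_exists_tendsto.mp hmap
  exact (hasDerivAt_iff_tendsto_slope.mpr hL).differentiableAt

end HolomorphicFamilies

section WeightedSpaces

theorem mem_disk {z : ℂ} : z ∈ disk ↔ ‖z‖ < 1 := mem_ball_zero_iff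

theorem eventually_toBoundary_iff {P : ℂ → Prop} :
    (∀ᶠ z in toBoundary, P z) ↔ ∃ r < 1, ∀ z : ℂ, r < ‖z‖ → ‖z‖ < 1 → P z := by
  rw [toBoundary, eventually_comap, eventually_iff, mem_nhdsLT_iff_exists_Ioo_subset]
  refine exists_congr fun r => and_congr_right fun _ => ⟨fun h z h1 h2 => h ⟨h1, h2⟩ z rfl, ?_⟩
  rintro h _ ht z rfl
  exact h z ht.1 ht.2

theorem eventually_mem_disk : ∀ᶠ z in toBoundary, z ∈ disk :=
  eventually_toBoundary_iff.mpr ⟨0, one_pos, fun _ _ h => mem_disk.mpr h⟩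

theorem tendsto_norm_toBoundary : Tendsto (fun z : ℂ => ‖z‖) toBoundary (𝓝 1) :=
  tendsto_comap.mono_right nhdsWithin_le_nhds

namespace RadialWeight

variable {ν : RadialWeight}

theorem le_of_norm_le {z w : ℂ} (hw : w ∈ disk) (h : ‖z‖ ≤ ‖w‖) : ν w ≤ ν z := by
  have hz : z ∈ disk := mem_disk.mpr (h.trans_lt (mem_disk.mp hw))
  rw [ν.radial z hz, ν.radial w hw]
  exact ν.antitone ⟨norm_nonneg z, mem_disk.mp hz⟩ ⟨norm_nonneg w, mem_disk.mp hw⟩ h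

end RadialWeight

theorem mem_hInfSubmodule_of_forall_le {ν : RadialWeight} {f : ℂ → ℂ} {M : ℝ} (hf : f ∈ Hol)
    (hM : ∀ z ∈ disk, ν z * ‖f z‖ ≤ M) : f ∈ hInfSubmodule ν :=
  ⟨hf, M, Set.forall_mem_range.mpr fun z => hM z z.2⟩

namespace HInf

variable {ν : RadialWeight}

theorem norm_apply_le (f : HInf ν) {z : ℂ} (hz : z ∈ disk) : ‖f z‖ ≤ ‖f‖ / ν z :=
  (le_div_iff₀' (ν.pos z hz)).mpr (f.weight_mul_le_norm hz)

theorem ext {f g : HInf ν} (h : ∀ z ∈ disk, f z = g z) : f = g := by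
  refine Subtype.ext (funext fun z => ?_)
  by_cases hz : z ∈ disk
  · exact h z hz
  · exact (f.apply_eq_zero hz).trans (g.apply_eq_zero hz).symm

theorem differentiableOn (f : HInf ν) : DifferentiableOn ℂ f disk := f.2.1.1

theorem evalCLM_apply (f : HInf ν) (z : ℂ) : evalCLM ν z f = f z := rfl

theorem evalCLM_eq_zero {z : ℂ} (hz : z ∉ disk) : evalCLM ν z = 0 :=
  ContinuousLinearMap.ext fun f => f.apply_eq_zero hz

theorem norm_evalCLM_le {z : ℂ} (hz : z ∈ disk) : ‖evalCLM ν z‖ ≤ (ν z)⁻¹ :=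
  ContinuousLinearMap.opNorm_le_bound _ (inv_nonneg.mpr (ν.pos z hz).le) fun f =>
    (f.norm_apply_le hz).trans_eq (div_eq_inv_mul _ _)

theorem differentiableOn_evalCLM : DifferentiableOn ℂ (evalCLM ν) disk := by
  intro c hc
  have hdisk : disk ∈ 𝓝 c := Metric.isOpen_ball.mem_nhds hc
  have hinv : ContinuousAt (fun z => (ν z)⁻¹) c :=
    (ν.continuousOn.continuousAt hdisk).inv₀ (ν.pos c hc).ne'
  obtain ⟨R, hR, hball⟩ := Metric.eventually_nhds_iff_ball.mp
    ((show ∀ᶠ z in 𝓝 c, z ∈ disk from hdisk).and (hinv.eventually_lt_const (lt_add_one _)))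
  exact (differentiableAt_of_forall_apply hR
    (fun f => f.differentiableOn.mono fun z hz => (hball z hz).1) fun z hz =>
      (norm_evalCLM_le (hball z hz).1).trans (hball z hz).2.le).differentiableWithinAt

variable (ν) in
/-- The contraction of the bidual of `H^∞_ν` to `H^∞_ν` that sends `G` to the function
`z ↦ G(δ_z)`, for the evaluations `δ_z` on `H^∞_ν`. It is a left inverse of the canonical
embedding. -/
def ofBidual : Bidual (HInf ν) →L[ℂ] HInf ν :=
  have hle (G : Bidual (HInf ν)) : ∀ z ∈ disk, ν z * ‖G (evalCLM ν z)‖ ≤ ‖G‖ := fun z hz => by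
    rw [← le_inv_mul_iff₀ (ν.pos z hz), mul_comm]
    exact G.le_opNorm_of_le (norm_evalCLM_le hz)
  let L : Bidual (HInf ν) →ₗ[ℂ] HInf ν :=
    { toFun := fun G => (⟨fun z => G (evalCLM ν z), mem_hInfSubmodule_of_forall_le
        ⟨G.differentiable.comp_differentiableOn differentiableOn_evalCLM,
          fun _ hz => (congrArg G (evalCLM_eq_zero hz)).trans (map_zero G)⟩
        (hle G)⟩ : hInfSubmodule ν)
      map_add' := fun _ _ => rfl
      map_smul' := fun _ _ => rfl }
  L.mkContinuous 1 fun G => (norm_le (hle G)).trans_eq (one_mul _).symm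

theorem ofBidual_apply (G : Bidual (HInf ν)) (z : ℂ) : ofBidual ν G z = G (evalCLM ν z) := rfl

theorem ofBidual_inclusionInDoubleDual (f : HInf ν) :
    ofBidual ν (NormedSpace.inclusionInDoubleDual ℂ (HInf ν) f) = f := rfl

instance : CompleteSpace (HInf ν) :=
  Metric.complete_of_cauchySeq_tendsto fun f hf => by
    obtain ⟨G, hG⟩ := cauchySeq_tendsto_of_complete
      ((NormedSpace.inclusionInDoubleDualLi ℂ).isometry.uniformContinuous.comp_cauchySeq hf)
    exact ⟨ofBidual ν G, ((ofBidual ν).continuous.tendsto G).comp hG⟩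

end HInf

variable {ν : RadialWeight}

theorem isClosed_hZero : IsClosed (HZero ν : Set (HInf ν)) := by
  refine isClosed_of_closure_subset fun f hf => Metric.tendsto_nhds.mpr fun ε hε => ?_
  obtain ⟨f₀, hf₀, hdist⟩ := Metric.mem_closure_iff.mp hf (ε / 2) (half_pos hε)
  filter_upwards [Metric.tendsto_nhds.mp hf₀ (ε / 2) (half_pos hε), eventually_mem_disk]
    with z hz hzd
  have hp := (ν.pos z hzd).le
  rw [dist_zero_right, Real.norm_of_nonneg (mul_nonneg hp (norm_nonneg _))] at hz ⊢
  calc ν z * ‖f z‖ ≤ ν z * (‖(f - f₀) z‖ + ‖f₀ z‖) :=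
        mul_le_mul_of_nonneg_left (norm_le_norm_sub_add (f z) (f₀ z)) hp
    _ = ν z * ‖(f - f₀) z‖ + ν z * ‖f₀ z‖ := mul_add _ _ _
    _ < ε / 2 + ε / 2 := add_lt_add
        (((f - f₀).weight_mul_le_norm hzd).trans_lt (dist_eq_norm f f₀ ▸ hdist)) hz
    _ = ε := add_halves ε

instance : CompleteSpace (HZero ν) := isClosed_hZero.completeSpace_coe

theorem delta_apply (f : HZero ν) (z : ℂ) : delta ν z f = (f : HInf ν) z := rfl

theorem differentiableOn_delta : DifferentiableOn ℂ (delta ν) disk :=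
  HInf.differentiableOn_evalCLM.clm_comp (differentiableOn_const (HZero ν).subtypeL)

end WeightedSpaces

section GlidingHump

theorem exists_finset_forall_norm_apply_le {𝕜 E : Type*} [RCLike 𝕜] [SeminormedAddCommGroup E]
    [NormedSpace 𝕜 E] {K : Set (StrongDual 𝕜 E)} (hK : IsCompact K) {ε : ℝ} (hε : 0 < ε) :
    ∃ s : Finset (StrongDual 𝕜 E), ↑s ⊆ K ∧ ∀ x, ‖x‖ ≤ 1 → (∀ x' ∈ s, ‖x' x‖ ≤ ε / 2) →
      ∀ x' ∈ K, ‖x' x‖ ≤ ε := by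
  obtain ⟨t, htK, ht, hcover⟩ := hK.finite_cover_balls (half_pos hε)
  refine ⟨ht.toFinset, by simpa using htK, fun x hx hxt x' hx' => ?_⟩
  obtain ⟨y', hy', hdist⟩ := Set.mem_iUnion₂.mp (hcover hx')
  have hy := hxt y' (ht.mem_toFinset.mpr hy')
  have hsub : ‖(x' - y') x‖ ≤ ε / 2 * 1 :=
    (x' - y').le_of_opNorm_le_of_le (mem_ball_iff_norm.mp hdist).le hx
  calc ‖x' x‖ ≤ ‖(x' - y') x‖ + ‖y' x‖ := by
        rw [sub_apply]
        exact norm_le_norm_sub_add _ _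
    _ ≤ ε := by linarith

theorem sum_le_add_sum_of_forall_lt_le_or_le {a b : ℕ → ℝ} {R : ℝ} (hR : 0 ≤ R)
    (hb : ∀ i, 0 ≤ b i) (ha : ∀ i, a i ≤ R) (hab : ∀ i j, i < j → a i ≤ b i ∨ a j ≤ b j)
    (s : Finset ℕ) : ∑ i ∈ s, a i ≤ R + ∑ i ∈ s, b i := by
  obtain ⟨i₀, hi₀⟩ : ∃ i₀, ∀ i, i ≠ i₀ → a i ≤ b i := by
    by_contra! h
    obtain ⟨i, -, hi⟩ := h 0
    obtain ⟨j, hji, hj⟩ := h i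
    rcases hji.lt_or_gt with hlt | hlt
    · exact (hab j i hlt).elim hj.not_ge hi.not_ge
    · exact (hab i j hlt).elim hi.not_ge hj.not_ge
  calc ∑ i ∈ s, a i ≤ ∑ i ∈ s, ((if i = i₀ then R else 0) + b i) :=
        Finset.sum_le_sum fun i _ => by
          split_ifs with hi
          · exact le_add_of_le_of_nonneg (ha i) (hb i)
          · exact (hi₀ i hi).trans_eq (zero_add _).symm
    _ ≤ R + ∑ i ∈ s, b i := by
        rw [Finset.sum_add_distrib, Finset.sum_ite_eq']
        gcongr
        split_ifs
        exacts [le_rfl, hR]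

variable {ν : RadialWeight}

theorem HInf.norm_sum_smul_le {ι : Type*} {s : Finset ι} {h : ι → HInf ν} {B : ℝ}
    (hB : ∀ z ∈ disk, ∑ i ∈ s, ν z * ‖h i z‖ ≤ B) {c : ι → ℂ} (hc : ∀ i, ‖c i‖ ≤ 1) :
    ‖∑ i ∈ s, c i • h i‖ ≤ B := by
  refine norm_le fun z hz => (mul_le_mul_of_nonneg_left ?_ (ν.pos z hz).le).trans
    ((Finset.mul_sum s _ _).trans_le (hB z hz))
  rw [← evalCLM_apply, map_sum]
  refine norm_sum_le_of_le s fun i _ => ?_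
  rw [map_smul, norm_smul]
  exact mul_le_of_le_one_left (norm_nonneg _) (hc i)

theorem exists_strictMono_forall_lt_le_or_le {ρ : ℕ → ℝ} (hρ : Tendsto ρ atTop (𝓝 1))
    {h : ℕ → HZero ν} (hh : ∀ n z, ‖z‖ ≤ ρ n → ν z * ‖(h n : HInf ν) z‖ ≤ (1 / 2) ^ n) :
    ∃ k : ℕ → ℕ, StrictMono k ∧ ∀ z ∈ disk, ∀ i j, i < j →
      ν z * ‖(h (k i) : HInf ν) z‖ ≤ (1 / 2) ^ i ∨
        ν z * ‖(h (k j) : HInf ν) z‖ ≤ (1 / 2) ^ j := by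
  have hev : ∀ m, ∀ᶠ n in atTop, m < n ∧
      ∀ z, ρ n < ‖z‖ → ‖z‖ < 1 → ν z * ‖(h m : HInf ν) z‖ ≤ (1 / 2) ^ m := fun m => by
    obtain ⟨r, hr, hrz⟩ := eventually_toBoundary_iff.mp
      ((h m).2.eventually_le_const (show (0 : ℝ) < (1 / 2) ^ m by positivity))
    filter_upwards [eventually_gt_atTop m, hρ.eventually_const_lt hr] with n hmn hrn
    exact ⟨hmn, fun z hz => hrz z (hrn.trans hz)⟩
  obtain ⟨k, -, hk⟩ := exists_seq_of_forall_finset_exists (fun _ => True) _ fun s _ =>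
    ((Finset.eventually_all s).mpr fun m _ => hev m).exists.imp fun _ hn => ⟨trivial, hn⟩
  have hmono : StrictMono k := fun i j hij => (hk i j hij).1
  have hpow : ∀ i, ((1 : ℝ) / 2) ^ k i ≤ (1 / 2) ^ i := fun i =>
    pow_le_pow_of_le_one (by norm_num) (by norm_num) hmono.le_apply
  refine ⟨k, hmono, fun z hz i j hij => ?_⟩
  rcases le_or_gt ‖z‖ (ρ (k j)) with hzj | hzj
  · exact Or.inr ((hh _ z hzj).trans (hpow j))
  · exact Or.inl (((hk i j hij).2 z hzj (mem_disk.mp hz)).trans (hpow i))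

-- Gliding hump: at each point of the disk at most one term of the subsequence is not small.
theorem exists_strictMono_forall_dual_summable {ρ : ℕ → ℝ} (hρ : Tendsto ρ atTop (𝓝 1))
    {h : ℕ → HZero ν} {R : ℝ} (hR : ∀ n, ‖h n‖ ≤ R)
    (hh : ∀ n z, ‖z‖ ≤ ρ n → ν z * ‖(h n : HInf ν) z‖ ≤ (1 / 2) ^ n) :
    ∃ k : ℕ → ℕ, StrictMono k ∧
      ∀ x' : StrongDual ℂ (HZero ν), Summable fun n => ‖x' (h (k n))‖ := by
  obtain ⟨k, hk, hor⟩ := exists_strictMono_forall_lt_le_or_le hρ hh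
  refine ⟨k, hk, summable_norm_dual_of_norm_sum_smul_le (B := R + 2) fun s c hc => ?_⟩
  have hsum : ∀ z ∈ disk, ∑ i ∈ s, ν z * ‖(h (k i) : HInf ν) z‖ ≤ R + 2 := fun z hz =>
    (sum_le_add_sum_of_forall_lt_le_or_le ((norm_nonneg _).trans (hR 0))
      (fun i => by positivity)
      (fun i => ((h (k i) : HInf ν).weight_mul_le_norm hz).trans (hR _)) (hor z hz) s).trans
      (add_le_add_right ((summable_geometric_two.sum_le_tsum s fun i _ => by positivity).trans_eq
        tsum_geometric_two) R)
  simpa using HInf.norm_sum_smul_le hsum hc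

theorem exists_finset_delta_forall_weight_mul_le (ν : RadialWeight) {r ε : ℝ} (hr : r < 1)
    (hε : 0 < ε) : ∃ s : Finset (StrongDual ℂ (HZero ν)), ↑s ⊆ delta ν '' disk ∧ ∃ d > 0,
      ∀ f : HZero ν, ‖f‖ ≤ 1 → (∀ x' ∈ s, ‖x' f‖ ≤ d) →
        ∀ z, ‖z‖ ≤ r → ν z * ‖(f : HInf ν) z‖ ≤ ε := by
  have hball : Metric.closedBall (0 : ℂ) r ⊆ disk := Metric.closedBall_subset_ball hr
  have h0 : 0 < ν 0 := ν.pos 0 (Metric.mem_ball_self one_pos)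
  obtain ⟨s, hs, hsmall⟩ := exists_finset_forall_norm_apply_le
    ((isCompact_closedBall (0 : ℂ) r).image_of_continuousOn
      (differentiableOn_delta.continuousOn.mono hball)) (div_pos hε h0)
  refine ⟨s, hs.trans (Set.image_mono hball), ε / ν 0 / 2, by positivity, fun f hf hfs z hz => ?_⟩
  have hzK : z ∈ Metric.closedBall 0 r := mem_closedBall_zero_iff.mpr hz
  calc ν z * ‖(f : HInf ν) z‖ ≤ ν 0 * (ε / ν 0) :=
        mul_le_mul (RadialWeight.le_of_norm_le (hball hzK) (by simp))
          (hsmall f hf hfs _ ⟨z, hzK, rfl⟩) (norm_nonneg _) h0.le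
    _ = ε := mul_div_cancel₀ ε h0.ne'

theorem isBallContinuous_of_bitranspose_mem_range {Y : Type} [NormedAddCommGroup Y]
    [NormedSpace ℂ Y] {T : HZero ν →L[ℂ] Y}
    (hT : ∀ F, bitranspose T F ∈ Set.range (NormedSpace.inclusionInDoubleDual ℂ Y)) :
    IsBallContinuous (delta ν '' disk) T := by
  intro ε hε
  by_contra! hcon
  obtain ⟨ρ, -, hρ1, hρ⟩ := exists_seq_strictMono_tendsto (1 : ℝ)
  choose s hs d hd hsmall using fun n =>
    exists_finset_delta_forall_weight_mul_le ν (hρ1 n) (show (0 : ℝ) < (1 / 2) ^ n by positivity)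
  choose h hh hhs hTh using fun n => hcon (s n) (hs n) (d n) (hd n)
  obtain ⟨k, -, hk⟩ := exists_strictMono_forall_dual_summable hρ hh fun n =>
    hsmall n (h n) (hh n) (hhs n)
  have hlim := (tendsto_cofinite_zero_of_bitranspose_mem_range hT hk).norm
  rw [norm_zero] at hlim
  obtain ⟨n, hn⟩ := (hlim.eventually_lt_const hε).exists
  exact hn.not_gt (hTh (k n))

theorem isCompactOperator_of_bitranspose_mem_range {Y : Type} [NormedAddCommGroup Y]
    [NormedSpace ℂ Y] [CompleteSpace Y] {T : HZero ν →L[ℂ] Y}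
    (hT : ∀ F, bitranspose T F ∈ Set.range (NormedSpace.inclusionInDoubleDual ℂ Y)) :
    IsCompactOperator T :=
  (isBallContinuous_of_bitranspose_mem_range hT).isCompactOperator

theorem mem_topologicalClosure_span_delta (x' : StrongDual ℂ (HZero ν)) :
    x' ∈ (Submodule.span ℂ (delta ν '' disk)).topologicalClosure :=
  (isBallContinuous_of_bitranspose_mem_range
    (bitranspose_functional_mem_range x')).mem_topologicalClosure_span

end GlidingHump

section Dilations

variable {ν : RadialWeight}

theorem mul_mem_disk {a z : ℂ} (ha : a ∈ disk) (hz : z ∈ disk) : a * z ∈ disk := by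
  rw [mem_disk, norm_mul] at *
  exact mul_lt_one_of_nonneg_of_lt_one_left (norm_nonneg a) ha hz.le

theorem norm_mul_le_of_mem_disk {a : ℂ} (ha : a ∈ disk) (z : ℂ) : ‖a * z‖ ≤ ‖z‖ := by
  rw [norm_mul]
  exact mul_le_of_le_one_left (norm_nonneg z) (mem_disk.mp ha).le

theorem HInf.norm_apply_mul_le (f : HInf ν) {a z : ℂ} (ha : a ∈ disk) (hz : z ∈ disk) :
    ‖f (a * z)‖ ≤ ‖f‖ / ν a := by
  refine (f.norm_apply_le (mul_mem_disk ha hz)).trans ?_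
  refine div_le_div_of_nonneg_left (norm_nonneg f) (ν.pos a ha) (RadialWeight.le_of_norm_le ha ?_)
  rw [mul_comm]
  exact norm_mul_le_of_mem_disk hz a

theorem HInf.tendsto_weight_mul_norm_mul (hν : Tendsto ν toBoundary (𝓝 0)) (f : HInf ν) {a : ℂ}
    (ha : a ∈ disk) : Tendsto (fun z => ν z * ‖f (a * z)‖) toBoundary (𝓝 0) := by
  have hlim : Tendsto (fun z => ν z * (‖f‖ / ν a)) toBoundary (𝓝 0) := by
    simpa using hν.mul_const (‖f‖ / ν a)
  refine squeeze_zero' (eventually_mem_disk.mono fun z hz => ?_)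
    (eventually_mem_disk.mono fun z hz => ?_) hlim
  · exact mul_nonneg (ν.pos z hz).le (norm_nonneg _)
  · exact mul_le_mul_of_nonneg_left (f.norm_apply_mul_le ha hz) (ν.pos z hz).le

/-- The dilation `z ↦ f (a z)` of `f ∈ H^∞_ν`, for `a` in the disk; it belongs to `H^0_ν` when
`ν` vanishes at the boundary. -/
def dilation (hν : Tendsto ν toBoundary (𝓝 0)) (f : HInf ν) (a : disk) : HZero ν :=
  have hF : ∀ z ∈ disk, disk.indicator (fun z => f (a * z)) z = f (a * z) := fun z hz =>
    Set.indicator_of_mem hz _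
  have hHol : (disk.indicator fun z => f (a * z)) ∈ Hol :=
    ⟨(f.differentiableOn.comp (by fun_prop) fun _ hz => mul_mem_disk a.2 hz).congr hF,
      fun _ hz => Set.indicator_of_notMem hz _⟩
  have hlim : Tendsto (fun z => ν z * ‖disk.indicator (fun z => f (a * z)) z‖) toBoundary (𝓝 0) :=
    (HInf.tendsto_weight_mul_norm_mul hν f a.2).congr' <| eventually_mem_disk.mono fun z hz =>
      congrArg (ν z * ‖·‖) (hF z hz).symm
  ⟨(⟨_, mem_hInfSubmodule_of_tendsto hHol hlim⟩ : hInfSubmodule ν), hlim⟩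

theorem dilation_apply (hν : Tendsto ν toBoundary (𝓝 0)) (f : HInf ν) (a : disk) {z : ℂ}
    (hz : z ∈ disk) : (dilation hν f a : HInf ν) z = f (a * z) :=
  Set.indicator_of_mem (f := fun z => f (a * z)) hz

theorem norm_dilation_le (hν : Tendsto ν toBoundary (𝓝 0)) (f : HInf ν) (a : disk) :
    ‖dilation hν f a‖ ≤ ‖f‖ := by
  have hle : ∀ z ∈ disk, ν z * ‖(dilation hν f a : HInf ν) z‖ ≤ ‖f‖ := fun z hz => by
    rw [dilation_apply hν f a hz]
    exact (mul_le_mul_of_nonneg_right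
      (RadialWeight.le_of_norm_le hz (norm_mul_le_of_mem_disk a.2 z)) (norm_nonneg _)).trans
      (f.weight_mul_le_norm (mul_mem_disk a.2 hz))
  exact HInf.norm_le hle

theorem tendsto_delta_dilation (hν : Tendsto ν toBoundary (𝓝 0)) (f : HInf ν) {z : ℂ}
    (hz : z ∈ disk) :
    Tendsto (fun a => delta ν z (dilation hν f a)) (comap (↑) (𝓝 (1 : ℂ))) (𝓝 (f z)) := by
  have hmul : Tendsto (fun a : disk => (a : ℂ) * z) (comap (↑) (𝓝 (1 : ℂ))) (𝓝 z) := by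
    simpa using (tendsto_comap (f := ((↑) : disk → ℂ)) (x := 𝓝 1)).mul_const z
  simp only [delta_apply, dilation_apply hν f _ hz]
  exact (f.differentiableOn.continuousOn.continuousAt
    (Metric.isOpen_ball.mem_nhds hz)).tendsto.comp hmul

instance : (comap ((↑) : disk → ℂ) (𝓝 1)).NeBot :=
  mem_closure_iff_comap_neBot.mp (by rw [closure_ball _ one_ne_zero]; simp)

end Dilations

section BidualOfHZero

variable {ν : RadialWeight}

variable (ν) in
/-- The operator from the bidual of `H^0_ν` to `H^∞_ν` that sends `F` to the function
`z ↦ F(δ_z)`. -/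
def ofBidualHZero : Bidual (HZero ν) →L[ℂ] HInf ν :=
  (HInf.ofBidual ν).comp (bitranspose (HZero ν).subtypeL)

theorem ofBidualHZero_apply (F : Bidual (HZero ν)) (z : ℂ) :
    ofBidualHZero ν F z = F (delta ν z) := rfl

theorem ofBidualHZero_injective : Function.Injective (ofBidualHZero ν) := by
  refine (injective_iff_map_eq_zero _).mpr fun F hF => ContinuousLinearMap.ext fun x' => ?_
  have hspan : Submodule.span ℂ (delta ν '' disk) ≤ F.ker :=
    Submodule.span_le.mpr <| Set.forall_mem_image.mpr fun z _ => by
      rw [SetLike.mem_coe, LinearMap.mem_ker, ContinuousLinearMap.coe_coe, ← ofBidualHZero_apply,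
        hF, HInf.zero_apply]
  exact Submodule.topologicalClosure_minimal _ hspan F.isClosed_ker
    (mem_topologicalClosure_span_delta x')

theorem ofBidualHZero_surjective (hν : Tendsto ν toBoundary (𝓝 0)) :
    Function.Surjective (ofBidualHZero ν) := by
  intro f
  obtain ⟨F, hF⟩ := exists_bidual_forall_tendsto (Ultrafilter.of (comap ((↑) : disk → ℂ) (𝓝 1)))
    (norm_dilation_le hν f)
  exact ⟨F, HInf.ext fun z hz => tendsto_nhds_unique (hF (delta ν z))
    ((tendsto_delta_dilation hν f hz).mono_left (Ultrafilter.of_le _))⟩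

/-- The canonical identification of the bidual of `H^0_ν` with `H^∞_ν`. -/
def bidualEquiv (hν : Tendsto ν toBoundary (𝓝 0)) : Bidual (HZero ν) ≃L[ℂ] HInf ν :=
  bidualEquivOfBijective (ofBidualHZero ν) ⟨ofBidualHZero_injective, ofBidualHZero_surjective hν⟩

theorem isCanonical_bidualEquiv (hν : Tendsto ν toBoundary (𝓝 0)) :
    IsCanonical ν (bidualEquiv hν) := fun _ _ _ => rfl

theorem tendsto_apply_dilation (hν : Tendsto ν toBoundary (𝓝 0)) (F : Bidual (HZero ν))
    (x' : StrongDual ℂ (HZero ν)) :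
    Tendsto (fun a => x' (dilation hν (bidualEquiv hν F) a)) (comap (↑) (𝓝 (1 : ℂ)))
      (𝓝 (F x')) :=
  tendsto_bidual_apply_of_mem_topologicalClosure_span (norm_dilation_le hν _)
    (Set.forall_mem_image.mpr fun _ hz => tendsto_delta_dilation hν _ hz)
    (mem_topologicalClosure_span_delta x')

end BidualOfHZero

section Extension

variable {ν μ : RadialWeight} (hν : Tendsto ν toBoundary (𝓝 0))

/-- The extension of an operator on `H^0_ν` to `H^∞_ν` given by its bi-transpose, read through the
canonical identifications. -/
def extension (T : HZero ν →L[ℂ] HInf μ) : HInf ν →L[ℂ] HInf μ :=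
  ((HInf.ofBidual μ).comp (bitranspose T)).comp
    ((bidualEquiv hν).symm : HInf ν →L[ℂ] Bidual (HZero ν))

theorem extension_bidualEquiv (T : HZero ν →L[ℂ] HInf μ) (F : Bidual (HZero ν)) :
    extension hν T (bidualEquiv hν F) = HInf.ofBidual μ (bitranspose T F) :=
  congrArg (fun G => HInf.ofBidual μ (bitranspose T G)) ((bidualEquiv hν).symm_apply_apply F)

theorem extension_bidualEquiv_eq_of_bitranspose_eq {T : HZero ν →L[ℂ] HInf μ}
    {F : Bidual (HZero ν)} {h : HInf μ}
    (hh : NormedSpace.inclusionInDoubleDual ℂ (HInf μ) h = bitranspose T F) :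
    extension hν T (bidualEquiv hν F) = h := by
  rw [extension_bidualEquiv, ← hh, HInf.ofBidual_inclusionInDoubleDual]

theorem bitranspose_mem_range_of_isWeaklyCompactOp_hZero (hν : Tendsto ν toBoundary (𝓝 0))
    {Y : Type} [NormedAddCommGroup Y] [NormedSpace ℂ Y] {T : HZero ν →L[ℂ] Y}
    (hT : IsWeaklyCompactOp T) (F : Bidual (HZero ν)) :
    bitranspose T F ∈ Set.range (NormedSpace.inclusionInDoubleDual ℂ Y) :=
  bitranspose_mem_range_of_isWeaklyCompactOp hT (norm_dilation_le hν _)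
    (tendsto_apply_dilation hν F)

theorem tfae_isCompactOperator_isWeaklyCompactOp_bitranspose_eq (T : HZero ν →L[ℂ] HInf μ) :
    [IsCompactOperator T,
      IsWeaklyCompactOp T,
      ∀ F, bitranspose T F =
        NormedSpace.inclusionInDoubleDual ℂ (HInf μ) (extension hν T (bidualEquiv hν F))].TFAE := by
  tfae_have 1 → 2 := isWeaklyCompactOp_of_isCompactOperator
  tfae_have 2 → 3 := by
    intro hT F
    obtain ⟨h, hh⟩ := bitranspose_mem_range_of_isWeaklyCompactOp_hZero hν hT F
    rw [extension_bidualEquiv_eq_of_bitranspose_eq hν hh, hh]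
  tfae_have 3 → 1 := fun h => isCompactOperator_of_bitranspose_mem_range fun F => ⟨_, (h F).symm⟩
  tfae_finish

theorem bidualEquiv_bitranspose (hμ : Tendsto μ toBoundary (𝓝 0)) (T : HZero ν →L[ℂ] HZero μ)
    (F : Bidual (HZero ν)) :
    bidualEquiv hμ (bitranspose T F) =
      extension hν ((HZero μ).subtypeL.comp T) (bidualEquiv hν F) := by
  rw [extension_bidualEquiv]
  rfl

theorem bidualEquiv_inclusionInDoubleDual (h : HZero ν) :
    bidualEquiv hν (NormedSpace.inclusionInDoubleDual ℂ (HZero ν) h) = h := rfl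

theorem isCompactOperator_iff_extension_mem_hZero (hμ : Tendsto μ toBoundary (𝓝 0))
    (T : HZero ν →L[ℂ] HZero μ) :
    IsCompactOperator T ↔ ∀ f, extension hν ((HZero μ).subtypeL.comp T) f ∈ HZero μ := by
  constructor
  · intro hT f
    obtain ⟨F, rfl⟩ := (bidualEquiv hν).surjective f
    obtain ⟨h, hh⟩ := bitranspose_mem_range_of_isWeaklyCompactOp_hZero hν
      (isWeaklyCompactOp_of_isCompactOperator hT) F
    rw [← bidualEquiv_bitranspose hν hμ, ← hh, bidualEquiv_inclusionInDoubleDual]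
    exact h.2
  · refine fun hT => isCompactOperator_of_bitranspose_mem_range fun F =>
      ⟨⟨_, hT (bidualEquiv hν F)⟩, (bidualEquiv hμ).injective ?_⟩
    rw [bidualEquiv_inclusionInDoubleDual, bidualEquiv_bitranspose hν]

end Extension

section Volterra

variable {ν μ : RadialWeight} {g φ : ℂ → ℂ}

theorem mapsTo_ofReal_mul_disk {z : ℂ} (hz : z ∈ disk) :
    Set.MapsTo (fun t : ℝ => (t : ℂ) * z) (Set.Icc 0 1) disk := fun t ht => by
  rw [mem_disk, norm_mul, Complex.norm_real, Real.norm_of_nonneg ht.1]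
  exact (mul_le_of_le_one_left (norm_nonneg z) ht.2).trans_lt (mem_disk.mp hz)

theorem extension_eq_volterra (hν : Tendsto ν toBoundary (𝓝 0)) (hg : DifferentiableOn ℂ g disk)
    (hφ : DifferentiableOn ℂ φ disk) (hφmaps : Set.MapsTo φ disk disk)
    {T : HZero ν →L[ℂ] HInf μ}
    (hT : ∀ f, ∀ z ∈ disk, T f z = volterra g φ (f : HInf ν) z) (f : HInf ν) {z : ℂ}
    (hz : z ∈ disk) : extension hν T f z = volterra g φ f z := by
  obtain ⟨F, rfl⟩ := (bidualEquiv hν).surjective f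
  let u : ℝ → StrongDual ℂ (HZero ν) := fun t =>
    (deriv g (t * z) * z) • delta ν (φ (t * z))
  have hseg : ContinuousOn (fun t : ℝ => (t : ℂ) * z) (Set.Icc 0 1) := by fun_prop
  have hu : ContinuousOn u (Set.Icc 0 1) :=
    (((hg.deriv Metric.isOpen_ball).continuousOn.comp hseg (mapsTo_ofReal_mul_disk hz)).mul
      continuousOn_const).smul
      ((differentiableOn_delta.continuousOn.comp hφ.continuousOn hφmaps).comp hseg
        (mapsTo_ofReal_mul_disk hz))
  rw [← Set.uIcc_of_le zero_le_one] at hu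
  have hTz : ∀ f, (HInf.evalCLM μ z).comp T f = ∫ t in (0 : ℝ)..1, u t f := fun f =>
    (hT f z hz).trans (intervalIntegral.integral_congr fun t _ => by
      change _ = deriv g (t * z) * z * (f : HInf ν) (φ (t * z))
      ring)
  rw [extension_bidualEquiv, HInf.ofBidual_apply, bitranspose_apply,
    bidual_apply_eq_intervalIntegral hu.intervalIntegrable hTz F]
  refine intervalIntegral.integral_congr fun t _ => ?_
  change F (u t) = F (delta ν (φ (t * z))) * deriv g (t * z) * z
  rw [map_smul, smul_eq_mul]
  ring

end Volterra

section LittleBloch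

variable {ν μ : RadialWeight} {γ : ℝ}

theorem RadialWeight.exists_mul_rpow_le
    (hμ : AlmostDecreasing fun r : ℝ => μ r / (1 - r ^ 2) ^ γ) (hγ : 0 < γ) :
    ∃ C : ℝ, 0 < C ∧ ∀ z ∈ disk, ∀ w, ‖w‖ ≤ ‖z‖ →
      μ z * (1 - ‖w‖) ^ γ ≤ C * μ w * (1 - ‖z‖) ^ γ := by
  obtain ⟨C, hC, h⟩ := hμ
  refine ⟨C * 2 ^ γ, by positivity, fun z hz w hwz => ?_⟩
  have hz1 := mem_disk.mp hz
  have hw := mem_disk.mpr (hwz.trans_lt hz1)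
  have hw1 := mem_disk.mp hw
  have key := h _ ⟨norm_nonneg w, hw1⟩ _ ⟨norm_nonneg z, hz1⟩ hwz
  simp only [← μ.radial z hz, ← μ.radial w hw] at key
  have hpz : 0 < 1 - ‖z‖ ^ 2 := by nlinarith [norm_nonneg z]
  have hpw : 0 < 1 - ‖w‖ ^ 2 := by nlinarith [norm_nonneg w]
  rw [div_le_iff₀ (Real.rpow_pos_of_pos hpz _), mul_div_assoc', div_mul_eq_mul_div,
    le_div_iff₀ (Real.rpow_pos_of_pos hpw _)] at key
  have hμw := μ.pos w hw
  calc μ z * (1 - ‖w‖) ^ γ ≤ μ z * (1 - ‖w‖ ^ 2) ^ γ := by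
        refine mul_le_mul_of_nonneg_left (Real.rpow_le_rpow (by linarith) ?_ hγ.le) (μ.pos z hz).le
        nlinarith [norm_nonneg w]
    _ ≤ C * μ w * (1 - ‖z‖ ^ 2) ^ γ := key
    _ ≤ C * μ w * (2 * (1 - ‖z‖)) ^ γ := by
        gcongr
        nlinarith
    _ = C * 2 ^ γ * μ w * (1 - ‖z‖) ^ γ := by
        rw [Real.mul_rpow zero_le_two (by linarith)]
        ring

theorem RadialWeight.tendsto_zero_of_almostDecreasing
    (hμ : AlmostDecreasing fun r : ℝ => μ r / (1 - r ^ 2) ^ γ) (hγ : 0 < γ) :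
    Tendsto μ toBoundary (𝓝 0) := by
  obtain ⟨C, -, h⟩ := RadialWeight.exists_mul_rpow_le hμ hγ
  have hlim : Tendsto (fun z : ℂ => C * μ 0 * (1 - ‖z‖) ^ γ) toBoundary (𝓝 0) := by
    simpa [Real.zero_rpow hγ.ne'] using
      ((tendsto_norm_toBoundary.const_sub 1).rpow_const (Or.inr hγ.le)).const_mul (C * μ 0)
  refine squeeze_zero' (eventually_mem_disk.mono fun z hz => (μ.pos z hz).le)
    (eventually_mem_disk.mono fun z hz => ?_) hlim
  simpa using h z hz 0 (by simp)

theorem RadialWeight.IsNormal.tendsto_zero (hμ : μ.IsNormal) : Tendsto μ toBoundary (𝓝 0) :=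
  let ⟨_, hγ, hdec⟩ := hμ.almostDecreasing
  tendsto_zero_of_almostDecreasing hdec hγ

theorem one_sub_mul_pos {a t : ℝ} (ha : a < 1) (ht : t ∈ Set.Icc (0 : ℝ) 1) : 0 < 1 - t * a := by
  rcases ht.1.eq_or_lt with rfl | htpos
  · simp
  · linarith [mul_lt_of_lt_one_right htpos ha, ht.2]

theorem intervalIntegrable_one_sub_mul_rpow {a : ℝ} (ha : a < 1) (p : ℝ) :
    IntervalIntegrable (fun t : ℝ => (1 - t * a) ^ p) MeasureTheory.volume 0 1 := by
  refine ContinuousOn.intervalIntegrable (ContinuousOn.rpow_const (by fun_prop) fun t ht => ?_)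
  rw [Set.uIcc_of_le zero_le_one] at ht
  exact Or.inl (one_sub_mul_pos ha ht).ne'

theorem integral_one_sub_mul_rpow_mul_le {a : ℝ} (ha : a < 1) (hγ : 0 < γ) :
    (∫ t in (0 : ℝ)..1, (1 - t * a) ^ (-γ - 1)) * a ≤ (1 - a) ^ (-γ) / γ := by
  have hderiv : ∀ t ∈ Set.uIcc (0 : ℝ) 1, HasDerivAt (fun t : ℝ => (1 - t * a) ^ (-γ) / γ)
      ((1 - t * a) ^ (-γ - 1) * a) t := by
    intro t ht
    rw [Set.uIcc_of_le zero_le_one] at ht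
    have hlin : HasDerivAt (fun t : ℝ => 1 - t * a) (-a) t := by
      simpa using ((hasDerivAt_id t).mul_const a).const_sub 1
    have hpow := (hlin.rpow_const (p := -γ) (Or.inl (one_sub_mul_pos ha ht).ne')).div_const γ
    refine hpow.congr_deriv ?_
    field_simp
  rw [← intervalIntegral.integral_mul_const, intervalIntegral.integral_eq_sub_of_hasDerivAt hderiv
    ((intervalIntegrable_one_sub_mul_rpow ha _).mul_const a)]
  simp only [one_mul, zero_mul, sub_zero, Real.one_rpow]
  exact sub_le_self _ (by positivity)

theorem exists_norm_le_add_div {k : ℂ → ℂ} (hk : ContinuousOn k disk) {ω : ℂ → ℝ}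
    (hω : ∀ w ∈ disk, 0 < ω w) (h : Tendsto (fun w => ω w * ‖k w‖) toBoundary (𝓝 0)) {δ : ℝ}
    (hδ : 0 < δ) : ∃ N : ℝ, 0 ≤ N ∧ ∀ w ∈ disk, ‖k w‖ ≤ N + δ / ω w := by
  obtain ⟨r, hr, hrw⟩ := eventually_toBoundary_iff.mp (h.eventually (gt_mem_nhds hδ))
  obtain ⟨N, hN⟩ := (isCompact_closedBall (0 : ℂ) r).exists_bound_of_continuousOn
    (hk.mono (Metric.closedBall_subset_ball hr))
  refine ⟨|N|, abs_nonneg N, fun w hw => ?_⟩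
  have hωw := hω w hw
  rcases le_or_gt ‖w‖ r with hwr | hwr
  · exact ((hN w (mem_closedBall_zero_iff.mpr hwr)).trans (le_abs_self N)).trans
      (le_add_of_nonneg_right (by positivity))
  · have hkw : ‖k w‖ ≤ δ / ω w := by
      rw [le_div_iff₀' hωw]
      exact (hrw w hwr (mem_disk.mp hw)).le
    exact hkw.trans (le_add_of_nonneg_left (abs_nonneg N))

theorem one_div_one_sub_sq_mul_weight_le {C : ℝ}
    (hC : 0 < C) {z w : ℂ} (hz : z ∈ disk) (hwz : ‖w‖ ≤ ‖z‖)
    (h : μ z * (1 - ‖w‖) ^ γ ≤ C * μ w * (1 - ‖z‖) ^ γ) :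
    1 / ((1 - ‖w‖ ^ 2) * μ w) ≤ C * (1 - ‖z‖) ^ γ / μ z * (1 - ‖w‖) ^ (-γ - 1) := by
  have hz1 := mem_disk.mp hz
  have hw1 := hwz.trans_lt hz1
  have hμz := μ.pos z hz
  have hμw := μ.pos w (mem_disk.mpr hw1)
  have hb : 0 < 1 - ‖w‖ := by linarith
  have hbsq : 1 - ‖w‖ ≤ 1 - ‖w‖ ^ 2 := by nlinarith [norm_nonneg w]
  have hsq : 0 < 1 - ‖w‖ ^ 2 := hb.trans_le hbsq
  have : 0 < 1 - ‖z‖ := by linarith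
  have hpow : (1 - ‖w‖) ^ (-γ - 1) = 1 / ((1 - ‖w‖) ^ γ * (1 - ‖w‖)) := by
    rw [Real.rpow_sub hb, Real.rpow_neg hb.le, Real.rpow_one]
    field_simp
  rw [hpow, div_mul_div_comm, div_le_div_iff₀ (by positivity) (by positivity), one_mul, mul_one]
  calc μ z * ((1 - ‖w‖) ^ γ * (1 - ‖w‖)) = μ z * (1 - ‖w‖) ^ γ * (1 - ‖w‖) := by ring
    _ ≤ C * μ w * (1 - ‖z‖) ^ γ * (1 - ‖w‖ ^ 2) := by gcongr
    _ = C * (1 - ‖z‖) ^ γ * ((1 - ‖w‖ ^ 2) * μ w) := by ring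

/-- Integration along the radius gains the factor `1 - |z|`, as the power `-γ - 1` of `1 - |w|`
integrates to the power `-γ`. -/
theorem weight_mul_norm_integral_radius_le {C : ℝ} (hC : 0 < C) (hγ : 0 < γ) {z : ℂ}
    (hz : z ∈ disk) (h : ∀ w, ‖w‖ ≤ ‖z‖ → μ z * (1 - ‖w‖) ^ γ ≤ C * μ w * (1 - ‖z‖) ^ γ)
    {k : ℂ → ℂ} {N δ : ℝ} (hN : 0 ≤ N) (hδ : 0 < δ)
    (hk : ∀ w ∈ disk, ‖k w‖ ≤ N + δ / ((1 - ‖w‖ ^ 2) * μ w)) :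
    μ z * ‖∫ t in (0 : ℝ)..1, k (t * z) * z‖ ≤ N * μ z + δ * (C / γ) := by
  have hz1 := mem_disk.mp hz
  have hμz := μ.pos z hz
  have hpos : 0 < (1 - ‖z‖) ^ γ := Real.rpow_pos_of_pos (by linarith) _
  set Q := δ * (C * (1 - ‖z‖) ^ γ / μ z) with hQ
  have hbound : ∀ t ∈ Set.Ioc (0 : ℝ) 1,
      ‖k (t * z) * z‖ ≤ (N + Q * (1 - t * ‖z‖) ^ (-γ - 1)) * ‖z‖ := by
    intro t ht
    have hnorm : ‖(t : ℂ) * z‖ = t * ‖z‖ := by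
      rw [norm_mul, Complex.norm_real, Real.norm_of_nonneg ht.1.le]
    have hle : ‖(t : ℂ) * z‖ ≤ ‖z‖ := hnorm ▸ mul_le_of_le_one_left (norm_nonneg z) ht.2
    have hcmp := one_div_one_sub_sq_mul_weight_le hC hz hle (h _ hle)
    rw [norm_mul, ← hnorm, hQ, mul_assoc]
    refine mul_le_mul_of_nonneg_right ((hk _ (mem_disk.mpr (hle.trans_lt hz1))).trans ?_)
      (norm_nonneg z)
    rw [div_eq_mul_one_div]
    exact add_le_add_right (mul_le_mul_of_nonneg_left hcmp hδ.le) N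
  have hint := intervalIntegrable_one_sub_mul_rpow hz1 (-γ - 1)
  have hI : ‖∫ t in (0 : ℝ)..1, k (t * z) * z‖ ≤ N * ‖z‖ + Q * ((1 - ‖z‖) ^ (-γ) / γ) := by
    refine (intervalIntegral.norm_integral_le_of_norm_le zero_le_one (Eventually.of_forall hbound)
      ((intervalIntegrable_const.add (hint.const_mul Q)).mul_const _)).trans ?_
    rw [intervalIntegral.integral_mul_const, intervalIntegral.integral_add intervalIntegrable_const
      (hint.const_mul Q), intervalIntegral.integral_const, intervalIntegral.integral_const_mul,
      sub_zero, one_smul, add_mul, mul_assoc]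
    gcongr
    exact integral_one_sub_mul_rpow_mul_le hz1 hγ
  calc μ z * ‖∫ t in (0 : ℝ)..1, k (t * z) * z‖
      ≤ μ z * (N * 1 + Q * ((1 - ‖z‖) ^ (-γ) / γ)) := by
        gcongr
        exact hI.trans (by gcongr)
    _ = N * μ z + δ * (C / γ) := by
        rw [hQ, Real.rpow_neg (by linarith)]
        field_simp

theorem tendsto_weight_mul_norm_integral_radius
    (hμ : AlmostDecreasing fun r : ℝ => μ r / (1 - r ^ 2) ^ γ) (hγ : 0 < γ) {k : ℂ → ℂ}
    (hk : ContinuousOn k disk)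
    (hlim : Tendsto (fun w => (1 - ‖w‖ ^ 2) * μ w * ‖k w‖) toBoundary (𝓝 0)) :
    Tendsto (fun z => μ z * ‖∫ t in (0 : ℝ)..1, k (t * z) * z‖) toBoundary (𝓝 0) := by
  obtain ⟨C, hC, hμC⟩ := RadialWeight.exists_mul_rpow_le hμ hγ
  have hω : ∀ w ∈ disk, 0 < (1 - ‖w‖ ^ 2) * μ w := fun w hw =>
    mul_pos (by nlinarith [norm_nonneg w, mem_disk.mp hw]) (μ.pos w hw)
  refine (nhds_basis_abs_sub_lt (0 : ℝ)).tendsto_right_iff.mpr fun ε hε => ?_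
  have hδ : 0 < ε / 2 / (C / γ) := by positivity
  obtain ⟨N, hN, hkN⟩ := exists_norm_le_add_div hk hω hlim hδ
  have hsmall : ∀ᶠ z in toBoundary, N * μ z < ε / 2 :=
    ((RadialWeight.tendsto_zero_of_almostDecreasing hμ hγ).const_mul N).eventually
      (gt_mem_nhds (by simpa using half_pos hε))
  filter_upwards [hsmall, eventually_mem_disk] with z hzε hz
  have hle := weight_mul_norm_integral_radius_le hC hγ hz (hμC z hz) hN hδ hkN
  rw [div_mul_cancel₀ _ (by positivity)] at hle
  have := mul_nonneg (μ.pos z hz).le (norm_nonneg (∫ t in (0 : ℝ)..1, k (t * z) * z))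
  simp only [sub_zero, abs_of_nonneg this]
  linarith

theorem tendsto_weight_mul_norm_volterra
    (hμ : AlmostDecreasing fun r : ℝ => μ r / (1 - r ^ 2) ^ γ) (hγ : 0 < γ) {g φ f : ℂ → ℂ}
    (hg : MemLittleBloch (fun z => (1 - ‖z‖ ^ 2) * μ z) g) (hf : ContinuousOn (f ∘ φ) disk)
    {K : ℝ} (hK : ∀ w ∈ disk, ‖f (φ w)‖ ≤ K) :
    Tendsto (fun z => μ z * ‖volterra g φ f z‖) toBoundary (𝓝 0) := by
  refine tendsto_weight_mul_norm_integral_radius hμ hγ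
    (k := fun w => f (φ w) * deriv g w)
    (hf.mul (hg.1.deriv Metric.isOpen_ball).continuousOn) ?_
  have hlim := hg.2.const_mul K
  rw [mul_zero] at hlim
  have hω : ∀ w ∈ disk, 0 ≤ (1 - ‖w‖ ^ 2) * μ w := fun w hw =>
    mul_nonneg (by nlinarith [norm_nonneg w, mem_disk.mp hw]) (μ.pos w hw).le
  refine squeeze_zero' (eventually_mem_disk.mono fun w hw => ?_)
    (eventually_mem_disk.mono fun w hw => ?_) hlim
  · exact mul_nonneg (hω w hw) (norm_nonneg _)
  · rw [norm_mul, mul_left_comm K]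
    exact mul_le_mul_of_nonneg_left
      (mul_le_mul_of_nonneg_right (hK w hw) (norm_nonneg _)) (hω w hw)

theorem mem_hZero_of_memLittleBloch (hν : Tendsto ν toBoundary (𝓝 0))
    (hμ : AlmostDecreasing fun r : ℝ => μ r / (1 - r ^ 2) ^ γ) (hγ : 0 < γ) {g φ : ℂ → ℂ}
    (hg : MemLittleBloch (fun z => (1 - ‖z‖ ^ 2) * μ z) g) (hφ : ContinuousOn φ disk)
    (hφmaps : Set.MapsTo φ disk disk) {T : HZero ν →L[ℂ] HInf μ}
    (hT : ∀ f, ∀ z ∈ disk, T f z = volterra g φ (f : HInf ν) z) (f : HZero ν) :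
    T f ∈ HZero μ := by
  have hmem : ∀ a, T (dilation hν f a) ∈ HZero μ := by
    intro a
    have hlim := tendsto_weight_mul_norm_volterra hμ hγ hg
      ((dilation hν f a : HInf ν).differentiableOn.continuousOn.comp hφ hφmaps)
      (K := ‖(f : HInf ν)‖ / ν a) fun w hw => by
        rw [dilation_apply hν f a (hφmaps hw)]
        exact HInf.norm_apply_mul_le _ a.2 (hφmaps hw)
    exact hlim.congr' (eventually_mem_disk.mono fun z hz =>
      congrArg (μ z * ‖·‖) (hT _ z hz).symm)
  have hweak := tendsto_apply_dilation hν (NormedSpace.inclusionInDoubleDual ℂ (HZero ν) f)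
  rw [bidualEquiv_inclusionInDoubleDual] at hweak
  exact mem_of_forall_dual_tendsto isClosed_hZero hmem fun y' => hweak (y'.comp T)

end LittleBloch

end VolterraComp

end

open VolterraComp in
theorem mainTheorem7_general (ν μ : RadialWeight) (hν : Tendsto ν toBoundary (𝓝 0))
    (hμ : Tendsto μ toBoundary (𝓝 0)) (g φ : ℂ → ℂ) (hg : DifferentiableOn ℂ g disk)
    (hφ : DifferentiableOn ℂ φ disk) (hφmaps : Set.MapsTo φ disk disk)
    (T : HZero ν →L[ℂ] HInf μ)
    (hT : ∀ f : HZero ν, ∀ z ∈ disk, T f z = volterra g φ (f : HInf ν) z) :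
    ∃ (Φν : Bidual (HZero ν) ≃L[ℂ] HInf ν) (Φμ : Bidual (HZero μ) ≃L[ℂ] HInf μ)
      (S : HInf ν →L[ℂ] HInf μ),
      IsCanonical ν Φν ∧ IsCanonical μ Φμ ∧
      (∀ f : HInf ν, ∀ z ∈ disk, S f z = volterra g φ f z) ∧
      [IsCompactOperator T,
        IsWeaklyCompactOp T,
        ∀ F : Bidual (HZero ν), bitranspose T F =
          NormedSpace.inclusionInDoubleDual ℂ (HInf μ) (S (Φν F))].TFAE ∧
      ((∃ γ : ℝ, 0 < γ ∧ AlmostDecreasing fun r : ℝ => μ r / (1 - r ^ 2) ^ γ) →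
        MemLittleBloch (fun z => (1 - ‖z‖ ^ 2) * μ z) g →
        ∃ T₀ : HZero ν →L[ℂ] HZero μ,
          (∀ f : HZero ν, ∀ z ∈ disk, (T₀ f : HInf μ) z = volterra g φ (f : HInf ν) z) ∧
          (∀ F : Bidual (HZero ν), Φμ (bitranspose T₀ F) = S (Φν F)) ∧
          (IsCompactOperator T₀ ↔ ∀ f : HInf ν, S f ∈ HZero μ)) := by
  refine ⟨bidualEquiv hν, bidualEquiv hμ, extension hν T, isCanonical_bidualEquiv hν,
    isCanonical_bidualEquiv hμ, fun f z hz => extension_eq_volterra hν hg hφ hφmaps hT f hz,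
    tfae_isCompactOperator_isWeaklyCompactOp_bitranspose_eq hν T, fun ⟨γ, hγ, hμγ⟩ hgμ => ?_⟩
  have hmem := mem_hZero_of_memLittleBloch hν hμγ hγ hgμ hφ.continuousOn hφmaps hT
  exact ⟨T.codRestrict (HZero μ) hmem, hT, bidualEquiv_bitranspose hν hμ _,
    isCompactOperator_iff_extension_mem_hZero hν hμ _⟩

theorem mainTheorem7 (ν μ : VolterraComp.RadialWeight) (hν : ν.IsNormal) (hμ : μ.IsNormal)
    (g φ : ℂ → ℂ) (hg : DifferentiableOn ℂ g VolterraComp.disk)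
    (hφ : DifferentiableOn ℂ φ VolterraComp.disk)
    (hφmaps : Set.MapsTo φ VolterraComp.disk VolterraComp.disk)
    -- `T` is the bounded operator `T_g^φ : H^0_ν → H^∞_μ`
    (T : VolterraComp.HZero ν →L[ℂ] VolterraComp.HInf μ)
    (hT : ∀ f : VolterraComp.HZero ν, ∀ z ∈ VolterraComp.disk,
      T f z = VolterraComp.volterra g φ (f : VolterraComp.HInf ν) z) :
    -- the canonical identifications of the biduals, and `T_g^φ : H^∞_ν → H^∞_μ`
    ∃ (Φν : VolterraComp.Bidual (VolterraComp.HZero ν) ≃L[ℂ] VolterraComp.HInf ν)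
      (Φμ : VolterraComp.Bidual (VolterraComp.HZero μ) ≃L[ℂ] VolterraComp.HInf μ)
      (S : VolterraComp.HInf ν →L[ℂ] VolterraComp.HInf μ),
      VolterraComp.IsCanonical ν Φν ∧ VolterraComp.IsCanonical μ Φμ ∧
      (∀ f : VolterraComp.HInf ν, ∀ z ∈ VolterraComp.disk,
        S f z = VolterraComp.volterra g φ f z) ∧
      [IsCompactOperator T,
        VolterraComp.IsWeaklyCompactOp T,
        ∀ F : VolterraComp.Bidual (VolterraComp.HZero ν),
          VolterraComp.bitranspose T F =
            NormedSpace.inclusionInDoubleDual ℂ (VolterraComp.HInf μ) (S (Φν F))].TFAE ∧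
      (VolterraComp.MemLittleBloch (fun z => (1 - ‖z‖ ^ 2) * μ z) g →
        ∃ T₀ : VolterraComp.HZero ν →L[ℂ] VolterraComp.HZero μ,
          (∀ f : VolterraComp.HZero ν, ∀ z ∈ VolterraComp.disk,
            (T₀ f : VolterraComp.HInf μ) z =
              VolterraComp.volterra g φ (f : VolterraComp.HInf ν) z) ∧
          (∀ F : VolterraComp.Bidual (VolterraComp.HZero ν),
            Φμ (VolterraComp.bitranspose T₀ F) = S (Φν F)) ∧
          (IsCompactOperator T₀ ↔
            ∀ f : VolterraComp.HInf ν, S f ∈ VolterraComp.HZero μ)) := by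
  obtain ⟨Φν, Φμ, S, hΦν, hΦμ, hS, htfae, hBloch⟩ :=
    mainTheorem7_general ν μ hν.tendsto_zero hμ.tendsto_zero g φ hg hφ hφmaps T hT
  exact ⟨Φν, Φμ, S, hΦν, hΦμ, hS, htfae, hBloch hμ.almostDecreasing⟩
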